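/- Let $K$ be a field of characteristic $0$ and let $n \ge k \ge 1$ be integers. The free Filippov $n$-algebra on a set $X$ is the $K$-vector space generated by all $n$-ary bracketings of elements of $X$, subject only to the consequences of $n$-linearity of the bracket, of antisymmetry $[x_1,\dots,x_n]=\operatorname{sgn}(\sigma)[x_{\sigma(1)},\dots,x_{\sigma(n)}]$ for $\sigma\in\mathfrak S_n$, and of the generalized Jacobi identity $$[[x_1,\dots,x_n],x_{n+1},\dots,x_{2n-1}]=\sum_{i=1}^n [x_1,\dots,x_{i-1},[x_i,x_{n+1},\dots,x_{2n-1}],x_{i+1},\dots,x_n].$$ Let $N=k(n-1)+1$, and let $\rho_{n,k}$ be the representation of $\mathfrak S_N$, acting by permutation of the letters, on the multilinear component of the free Filippov $n$-algebra on $N$ letters, that is, on the span of the bracketed words with $k$ brackets in which every letter occurs exactly once. For a partition $\lambda$ of $N$ let $S^\lambda$ denote the Specht module of $\mathfrak S_N$ over $K$ (so that $S^{(N)}$ is the trivial and $S^{(1^N)}$ the sign representation). Theorem. Every irreducible constituent of $\rho_{n,k}$ has exactly $k$ columns. That is, every irreducible subrepresentation of $\rho_{n,k}$ is isomorphic to $S^\lambda$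 for some partition $\lambda$ of $N$ whose Young diagram has exactly $k$ columns; and whenever $S^\lambda$, with $\lambda$ a partition of $N$, is isomorphic to a subrepresentation of $\rho_{n,k}$, the Young diagram of $\lambda$ has exactly $k$ columns. -/

import Mathlib

/-- Bracketed words for one formal `n`-ary bracket on the alphabet `X`: a word is a letter or
a bracket `[w₁, …, wₙ]` of `n` words. -/
inductive BWord (n : ℕ) (X : Type*) : Type _
  | leaf : X → BWord n X
  | node : (Fin n → BWord n X) → BWord n X

namespace BWord

variable {n : ℕ} {X Y Z : Type*}

/-- Replace every letter `x` of a bracketed word by `f x`. -/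
def map (f : X → Y) : BWord n X → BWord n Y
  | leaf x => leaf (f x)
  | node w => node fun i => (w i).map f

/-- The multiset of letters of a bracketed word. -/
def letters : BWord n X → Multiset X
  | leaf x => {x}
  | node w => ∑ i, (w i).letters

/-- The number of brackets of a bracketed word. -/
def brackets : BWord n X → ℕ
  | leaf _ => 0
  | node w => 1 + ∑ i, (w i).brackets

theorem map_id (w : BWord n X) : w.map id = w := by
  induction w with
  | leaf x => rfl
  | node w ih => simp only [map, ih]

theorem map_map (f : X → Y) (g : Y → Z) (w : BWord n X) :
    (w.map f).map g = w.map (g ∘ f) := by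
  induction w with
  | leaf x => rfl
  | node w ih => simp only [map, ih]

theorem letters_map (f : X → Y) (w : BWord n X) : (w.map f).letters = w.letters.map f := by
  induction w with
  | leaf x => simp [map, letters]
  | node w ih =>
    simp only [map, letters, ih]
    exact (map_sum (Multiset.mapAddMonoidHom f) (fun i => (w i).letters) Finset.univ).symm

theorem brackets_map (f : X → Y) (w : BWord n X) : (w.map f).brackets = w.brackets := by
  induction w with
  | leaf x => rfl
  | node w ih => simp only [map, brackets, ih]

theorem map_update (f : X → Y) (w : Fin n → BWord n X) (i : Fin n) (u : BWord n X) :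
    (fun j => (Function.update w i u j).map f)
      = Function.update (fun j => (w j).map f) i (u.map f) := by
  funext j
  by_cases h : j = i
  · subst h; simp
  · simp [h]

end BWord

section FreeFilippov

variable (K : Type*) [Field K] (n : ℕ) (X : Type*)

/-- The free `n`-ary algebra on `X`: the vector space with basis the bracketed words, the bracket
being the multilinear extension of `BWord.node`. -/
abbrev FreeNary := BWord n X →₀ K

variable {K n X}

/-- The linear map `u ↦ [w₁, …, wᵢ₋₁, u, wᵢ₊₁, …, wₙ]`. -/
noncomputable def bracketAt (w : Fin n → BWord n X) (i : Fin n) :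
    FreeNary K n X →ₗ[K] FreeNary K n X :=
  Finsupp.lmapDomain K K fun u => BWord.node (Function.update w i u)

open BWord in
/-- The relations of the free Filippov `n`-algebra: antisymmetry, the generalized Jacobi identity
`[[x₁, …, xₙ], y₂, …, yₙ] = ∑ᵢ [x₁, …, [xᵢ, y₂, …, yₙ], …, xₙ]`, and what follows from these by
bracketing. Both identities are multilinear, so it is enough to impose them on words.
Here `z` is the first of the `n` slots, so that `Function.update y z u` is `(u, y₂, …, yₙ)`. -/
inductive FilippovRel : FreeNary K n X → Prop
  | antisymm (σ : Equiv.Perm (Fin n)) (x : Fin n → BWord n X) :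
      FilippovRel (Finsupp.single (node x) 1
        - ((Equiv.Perm.sign σ : ℤ) : K) • Finsupp.single (node fun i => x (σ i)) 1)
  | jacobi (z : Fin n) (hz : (z : ℕ) = 0) (x y : Fin n → BWord n X) :
      FilippovRel (Finsupp.single (node (Function.update y z (node x))) 1
        - ∑ i, Finsupp.single
            (node (Function.update x i (node (Function.update y z (x i))))) 1)
  | bracket (w : Fin n → BWord n X) (i : Fin n) {r : FreeNary K n X} :
      FilippovRel r → FilippovRel (bracketAt w i r)

variable (K n X) in
/-- The ideal of the free `n`-ary algebra generated by antisymmetry and the generalized Jacobi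
identity. -/
noncomputable def filippovIdeal : Submodule K (FreeNary K n X) :=
  Submodule.span K {r | FilippovRel r}

variable (K n X) in
/-- The free Filippov `n`-algebra on `X`. -/
abbrev FreeFilippov := FreeNary K n X ⧸ filippovIdeal K n X

/-- Relabelling the letters of words, extended linearly. -/
noncomputable def relabel (f : X → X) : FreeNary K n X →ₗ[K] FreeNary K n X :=
  Finsupp.lmapDomain K K (BWord.map f)

theorem relabel_single (f : X → X) (w : BWord n X) (c : K) :
    relabel f (Finsupp.single w c) = Finsupp.single (w.map f) c := by
  simp [relabel]

theorem FilippovRel.relabel (f : X → X) {r : FreeNary K n X} (h : FilippovRel r) :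
    FilippovRel (relabel f r) := by
  induction h with
  | antisymm σ x =>
    rw [map_sub, map_smul, relabel_single, relabel_single]
    exact FilippovRel.antisymm σ fun i => (x i).map f
  | jacobi z hz x y =>
    rw [map_sub, map_sum]
    simp only [relabel_single, BWord.map, BWord.map_update]
    exact FilippovRel.jacobi z hz (fun i => (x i).map f) (fun i => (y i).map f)
  | bracket w i _ ih =>
    rename_i r _
    have : _root_.relabel f (bracketAt w i r)
        = bracketAt (fun j => (w j).map f) i (_root_.relabel f r) := by
      simp only [_root_.relabel, bracketAt, Finsupp.lmapDomain_apply, ← Finsupp.mapDomain_comp]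
      congr 1
      funext u
      simp only [Function.comp, BWord.map, BWord.map_update]
    rw [this]
    exact FilippovRel.bracket _ i ih

theorem filippovIdeal_le_comap (f : X → X) :
    filippovIdeal K n X ≤ (filippovIdeal K n X).comap (relabel f) :=
  Submodule.span_le.2 fun _ hr => Submodule.subset_span (FilippovRel.relabel f hr)

variable (K n X) in
/-- The symmetric group of `X` acts on the free Filippov `n`-algebra on `X` by replacing every
letter by its image. -/
noncomputable def freeFilippovRep : Representation K (Equiv.Perm X) (FreeFilippov K n X) where
  toFun σ := (filippovIdeal K n X).mapQ _ (relabel σ) (filippovIdeal_le_comap σ)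
  map_one' := by
    ext w
    simp only [LinearMap.comp_apply, Finsupp.lsingle_apply, Submodule.mkQ_apply,
      Submodule.mapQ_apply, relabel_single]
    exact congrArg (fun v => Submodule.Quotient.mk (Finsupp.single v (1 : K))) (BWord.map_id w)
  map_mul' σ τ := by
    ext w
    simp only [LinearMap.comp_apply, Finsupp.lsingle_apply, Submodule.mkQ_apply,
      Module.End.mul_apply, Submodule.mapQ_apply, relabel_single, BWord.map_map]
    rfl

theorem freeFilippovRep_mk_single (σ : Equiv.Perm X) (w : BWord n X) :
    freeFilippovRep K n X σ (Submodule.Quotient.mk (Finsupp.single w 1))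
      = Submodule.Quotient.mk (Finsupp.single (w.map σ) 1) := by
  simp only [freeFilippovRep, MonoidHom.coe_mk, OneHom.coe_mk, Submodule.mapQ_apply,
    relabel_single]

variable (K n) in
/-- The multilinear component of the free Filippov `n`-algebra on the finite set `X`, with `k`
brackets: the span of the bracketed words with `k` brackets in which every letter of `X` occurs
exactly once. -/
noncomputable def multilinearComponent (X : Type*) [Fintype X] (k : ℕ) :
    Subrepresentation (freeFilippovRep K n X) where
  toSubmodule := Submodule.span K
    {v | ∃ w : BWord n X, w.brackets = k ∧ w.letters = Finset.univ.val ∧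
      v = Submodule.Quotient.mk (Finsupp.single w 1)}
  apply_mem_toSubmodule σ v hv := by
    induction hv using Submodule.span_induction with
    | mem v hv =>
      obtain ⟨w, hk, hw, rfl⟩ := hv
      rw [freeFilippovRep_mk_single]
      refine Submodule.subset_span ⟨w.map σ, ?_, ?_, rfl⟩
      · rw [BWord.brackets_map, hk]
      · rw [BWord.letters_map, hw, Multiset.map_univ_val_equiv]
    | zero => simp
    | add x y _ _ hx hy => rw [map_add]; exact Submodule.add_mem _ hx hy
    | smul c x _ hx => rw [map_smul]; exact Submodule.smul_mem _ c hx

variable (K n) in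
/-- The representation `ρ_{n,k}` of the symmetric group on `k(n-1)+1` letters. -/
noncomputable def rho (k : ℕ) :
    Representation K (Equiv.Perm (Fin (k * (n - 1) + 1)))
      (multilinearComponent K n (Fin (k * (n - 1) + 1)) k).toSubmodule :=
  (multilinearComponent K n (Fin (k * (n - 1) + 1)) k).toRepresentation

end FreeFilippov

section Specht

variable (K : Type*) [Field K] (N : ℕ)

/-- The permutation module in which the (row) tabloids live. A tabloid is recorded as the map
sending an entry to the index of the row that contains it; a permutation `σ` replaces every entry
by its image. -/
noncomputable def tabloidRep : Representation K (Equiv.Perm (Fin N)) ((Fin N → ℕ) →₀ K) where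
  toFun σ := Finsupp.lmapDomain K K fun T i => T (σ⁻¹ i)
  map_one' := by
    ext T : 2
    simp
  map_mul' σ τ := by
    ext T : 2
    simp [mul_inv_rev]

variable {N}

/-- A Young tableau of shape `μ` with entries `Fin N`: a bijective filling of the cells. -/
abbrev Tableau (μ : YoungDiagram) (N : ℕ) := {c // c ∈ μ.cells} ≃ Fin N

/-- The tabloid of a tableau. -/
def Tableau.tabloid {μ : YoungDiagram} (t : Tableau μ N) : Fin N → ℕ :=
  fun i => (t.symm i).1.1

/-- The column of the tableau `t` that contains the entry `i`. -/
def Tableau.colOf {μ : YoungDiagram} (t : Tableau μ N) (i : Fin N) : ℕ := (t.symm i).1.2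

/-- The polytabloid `∑ sgn(q) q{t}`, with `q` running over the permutations that preserve
every column of `t`. -/
noncomputable def polytabloid {μ : YoungDiagram} (t : Tableau μ N) : (Fin N → ℕ) →₀ K :=
  ∑ q : Equiv.Perm (Fin N) with ∀ i, t.colOf (q i) = t.colOf i,
    ((Equiv.Perm.sign q : ℤ) : K) • tabloidRep K N q (Finsupp.single t.tabloid 1)

theorem tabloidRep_polytabloid {μ : YoungDiagram} (σ : Equiv.Perm (Fin N)) (t : Tableau μ N) :
    tabloidRep K N σ (polytabloid K t) = polytabloid K (t.trans σ) := by
  have htab : Finsupp.single (Tableau.tabloid (t.trans σ)) (1 : K)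
      = tabloidRep K N σ (Finsupp.single t.tabloid 1) := by
    simp [tabloidRep]
    rfl
  have hcol : ∀ i, Tableau.colOf (t.trans σ) i = t.colOf (σ⁻¹ i) := fun i => rfl
  simp only [polytabloid, map_sum, map_smul, htab]
  refine Finset.sum_bij (fun q _ => σ * q * σ⁻¹) ?_ ?_ ?_ ?_
  · intro q hq
    simp only [Finset.mem_filter, Finset.mem_univ, true_and, hcol] at hq ⊢
    intro i
    simpa using hq (σ⁻¹ i)
  · intro q _ q' _ h
    simpa using h
  · intro q hq
    refine ⟨σ⁻¹ * q * σ, ?_, by group⟩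
    simp only [Finset.mem_filter, Finset.mem_univ, true_and, hcol] at hq ⊢
    intro i
    simpa using hq (σ i)
  · intro q _
    have hs : Equiv.Perm.sign (σ * q * σ⁻¹) = Equiv.Perm.sign q := by
      rw [map_mul, map_mul, map_inv, mul_comm, inv_mul_cancel_left]
    rw [hs, ← Module.End.mul_apply, ← Module.End.mul_apply, ← map_mul, ← map_mul]
    simp

variable (N) in
/-- The subspace spanned by the polytabloids of shape `μ`, with the action of the symmetric
group. -/
noncomputable def spechtSub (μ : YoungDiagram) : Subrepresentation (tabloidRep K N) where
  toSubmodule := Submodule.span K (Set.range fun t : Tableau μ N => polytabloid K t)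
  apply_mem_toSubmodule σ v hv := by
    induction hv using Submodule.span_induction with
    | mem v hv =>
      obtain ⟨t, rfl⟩ := hv
      simp only [tabloidRep_polytabloid]
      exact Submodule.subset_span ⟨t.trans σ, rfl⟩
    | zero => simp
    | add x y _ _ hx hy => rw [map_add]; exact Submodule.add_mem _ hx hy
    | smul c x _ hx => rw [map_smul]; exact Submodule.smul_mem _ c hx

variable (N) in
/-- The Specht module `S^μ` of the symmetric group on `N` letters, for `μ` with `N` cells. -/
noncomputable def specht (μ : YoungDiagram) :
    Representation K (Equiv.Perm (Fin N)) (spechtSub K N μ).toSubmodule :=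
  (spechtSub K N μ).toRepresentation

end Specht

/-- The number of columns of a Young diagram. -/
def YoungDiagram.numCols (μ : YoungDiagram) : ℕ := μ.rowLen 0

/-! Write `n = p + 1` and `k = m + 1`. Modulo the generalized Jacobi identity every word is a
combination of left-normed words, in which only the first entry of a bracket may be a bracket
(`wordClass_mem_leftNormedSpan`). A left-normed word is alternating in the letters of each of its
`k` blocks, the innermost letter being counted with the innermost bracket. A copy of `S^λ` contains
a nonzero vector fixed by the row group of a tableau, and a polytabloid, on which the column group
acts by the sign. Both are tested against linear functionals with the same symmetry.

At most `k` columns: if the first row has more than `k` letters, two of them share a block of any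
given left-normed word, so a functional symmetric in these letters kills it
(`eq_zero_of_symmetric`).

At least `k` columns: suppose there are at most `m`. The values of an alternating functional on
left-normed words, twisted by the sign, form a function of the arrangements of the letters that is
symmetric within the blocks and within the columns. It is encoded in a polynomial `F` in the entries
of a matrix whose rows are the blocks and which has `m` columns. The polarizations `E i j = ∑ x_ic
∂/∂x_jc` act on such polynomials as the matrix units of `gl`, and the Jacobi identity for
consecutive brackets becomes `F = E 0 1 (E 1 0 F)` and `F = ± S F + E i (i+1) (E (i+1) i F)` for `i
≥ 1`, with `S` the exchange of two rows. By `sl₂` theory `E 0 1 F = 0` and `E i (i+1) ^ 2 F = 0`.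
Commutators then show that all products of `m` operators `E i m`, `i < m`, kill `F`
(`killedBy_of_simple_roots`). The rows above row `m` form a generic, hence nonsingular, square
matrix, and `F` has degree `p ≥ m` in row `m`; so `F = 0` (`eq_zero_of_killedBy_polarization`). Here
`k ≤ n` is used.

That every irreducible representation is a Specht module follows from the dominance order and from
counting characters against cycle types (`exists_equiv_specht`). -/

/-! ### Raising operators: `sl₂` arguments and nilpotency from simple roots. -/

section RaisingOperators

variable {K V : Type*} [Field K] [AddCommGroup V] [Module K V]

theorem weight_pow_apply {D H : Module.End K V} (hHD : ∀ v, H (D v) = D (H v) + (2 : K) • D v)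
    {c : K} {v : V} (hv : H v = c • v) (r : ℕ) :
    H ((D ^ r) v) = (c + 2 * r) • (D ^ r) v := by
  induction r with
  | zero => simp [hv]
  | succ r ih =>
    rw [pow_succ', Module.End.mul_apply, hHD, ih, map_smul, ← add_smul]
    congr 1
    push_cast
    ring

/-- Each of the `r + 1` factors `D` that passes `U` leaves an `H`; the eigenvalues met are `c, c +
2, …, c + 2r`, with sum `(r + 1)(c + r)`. -/
theorem raising_pow_lowering_apply {D U H : Module.End K V}
    (hDU : ∀ v, D (U v) = U (D v) + H v) (hHD : ∀ v, H (D v) = D (H v) + (2 : K) • D v)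
    {c : K} {v : V} (hv : H v = c • v) (r : ℕ) :
    (D ^ (r + 1)) (U v) = U ((D ^ (r + 1)) v) + ((r + 1) * (c + r) : K) • (D ^ r) v := by
  induction r with
  | zero => simp [hDU, hv]
  | succ r ih =>
    rw [pow_succ', Module.End.mul_apply, ih, map_add, hDU, weight_pow_apply hHD hv,
      map_smul, ← Module.End.mul_apply D, ← Module.End.mul_apply D, ← pow_succ', ← pow_succ',
      add_assoc, ← add_smul]
    congr 2
    push_cast
    ring

/-- Downward induction on the exponent for a nilpotent operator. -/
theorem pow_apply_eq_zero_of_step {D : Module.End K V} {v : V} {R r₀ : ℕ} (hR : (D ^ R) v = 0)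
    (step : ∀ r, r₀ ≤ r → (D ^ (r + 1)) v = 0 → (D ^ r) v = 0) : (D ^ r₀) v = 0 := by
  by_cases hr : R ≤ r₀
  · obtain ⟨s, rfl⟩ := Nat.exists_eq_add_of_le' hr
    rw [pow_add, Module.End.mul_apply, hR, map_zero]
  · exact Nat.decreasingInduction' (P := fun r => (D ^ r) v = 0)
      (fun r _ h ih => step r h ih) (not_le.1 hr).le hR

/-- On the weight `1` space of the irreducible `sl₂`-module of highest weight `2r + 1`, `D U` acts
by `(r + 1)²`, which equals `1` only for `r = 0`. The descent on powers of `D` avoids any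
decomposition into irreducibles. -/
theorem raising_eq_zero_of_eq_raising_lowering [CharZero K] {D U H : Module.End K V}
    (hDU : ∀ v, D (U v) = U (D v) + H v) (hHD : ∀ v, H (D v) = D (H v) + (2 : K) • D v)
    {v : V} (hv : H v = v) (hvv : v = D (U v)) {R : ℕ} (hR : (D ^ R) v = 0) : D v = 0 := by
  have := pow_apply_eq_zero_of_step (r₀ := 1) hR fun r hr h => by
    have h1 := raising_pow_lowering_apply hDU hHD (c := 1) (by rw [hv, one_smul]) r
    rw [h, map_zero, zero_add, pow_succ, Module.End.mul_apply, ← hvv] at h1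
    have h2 : ((r + 1) * (1 + r) - 1 : K) • (D ^ r) v = 0 := by
      rw [sub_smul, ← h1, one_smul, sub_self]
    refine (smul_eq_zero.1 h2).resolve_left ?_
    have : ((r + 1) * (1 + r) - 1 : K) = ((r * (r + 2) : ℕ) : K) := by push_cast; ring
    rw [this]
    exact Nat.cast_ne_zero.2 (by positivity)
  simpa using this

/-- On the zero weight space of highest weight `2r`, `D U` acts by `r(r + 1)`, while `ε S` squares
to `1`. Hence `1 - r(r + 1) = ±1`, that is, `r ≤ 1`. As `S v` need not be a multiple of `v`, the
descent treats both together: it solves a two-by-two system with determinant `(1 - r(r + 1))² - 1`,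
nonzero for `r ≥ 2`. -/
theorem raising_sq_eq_zero_of_eq_swap_add [CharZero K] {D U H S : Module.End K V}
    (hDU : ∀ v, D (U v) = U (D v) + H v) (hHD : ∀ v, H (D v) = D (H v) + (2 : K) • D v)
    (hSD : ∀ v, S (D v) = U (S v)) (hSU : ∀ v, S (U v) = D (S v)) (hSS : ∀ v, S (S v) = v)
    {v : V} (hv : H v = 0) (hSv : H (S v) = 0) {ε : K} (hε : ε * ε = 1)
    (hvv : v = ε • S v + D (U v))
    {R : ℕ} (hR : (D ^ R) v = 0) (hR' : (D ^ R) (S v) = 0) : (D ^ 2) v = 0 := by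
  have hSvv : S v = ε • v + D (U (S v)) := by
    conv_lhs => rw [hvv]
    rw [map_add, map_smul, hSS, hSD, hSU, hDU (S v), hSv, add_zero]
  have key : ∀ a b : V, H a = 0 → a = ε • b + D (U a) → ∀ r : ℕ, (D ^ (r + 1)) a = 0 →
      (1 - r * (r + 1) : K) • (D ^ r) a = ε • (D ^ r) b := by
    intro a b ha hab r hr
    have hHa : H (D a) = (2 : K) • D a := by rw [hHD, ha, map_zero, zero_add]
    have h0 : (D ^ r) a = ε • (D ^ r) b + (D ^ r) (U (D a)) := by
      conv_lhs => rw [hab]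
      rw [map_add, map_smul, hDU, ha, add_zero]
    cases r with
    | zero =>
      have hr' : D a = 0 := by simpa using hr
      simpa [hr'] using h0
    | succ r =>
      rw [raising_pow_lowering_apply hDU hHD hHa r, ← Module.End.mul_apply _ D,
        ← Module.End.mul_apply _ D, ← pow_succ, ← pow_succ, hr, map_zero, zero_add] at h0
      rw [sub_smul, one_smul, sub_eq_iff_eq_add]
      conv_lhs => rw [h0]
      congr 2
      push_cast
      ring
  have hpair : ∀ r, 2 ≤ r → (D ^ (r + 1)) v = 0 ∧ (D ^ (r + 1)) (S v) = 0 →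
      (D ^ r) v = 0 ∧ (D ^ r) (S v) = 0 := by
    rintro r hr ⟨h1, h2⟩
    have e1 := key v (S v) hv hvv r h1
    have e2 := key (S v) v hSv hSvv r h2
    have hc : ((1 - r * (r + 1)) * (1 - r * (r + 1)) - 1 : K) ≠ 0 := by
      obtain ⟨s, rfl⟩ := Nat.exists_eq_add_of_le' hr
      have : ((1 - (s + 2 : ℕ) * ((s + 2 : ℕ) + 1)) * (1 - (s + 2 : ℕ) * ((s + 2 : ℕ) + 1)) - 1 : K)
          = (((s + 2) * (s + 3) * (s ^ 2 + 5 * s + 4) : ℕ) : K) := by push_cast; ring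
      rw [this, Nat.cast_ne_zero]
      positivity
    have fin : ∀ x y : V, (1 - r * (r + 1) : K) • x = ε • y → (1 - r * (r + 1) : K) • y = ε • x →
        x = 0 := by
      intro x y hx hy
      have : ((1 - r * (r + 1)) * (1 - r * (r + 1)) - 1 : K) • x = 0 := by
        rw [sub_smul, mul_smul, hx, smul_comm, hy, smul_smul, hε, one_smul, sub_self]
      exact (smul_eq_zero.1 this).resolve_left hc
    exact ⟨fin _ _ e1 e2, fin _ _ e2 e1⟩
  by_cases hr : R ≤ 2
  · obtain ⟨s, hs⟩ := Nat.exists_eq_add_of_le' hr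
    rw [hs, pow_add, Module.End.mul_apply, hR, map_zero]
  · exact (Nat.decreasingInduction' (P := fun r => (D ^ r) v = 0 ∧ (D ^ r) (S v) = 0)
      (fun r _ h ih => hpair r h ih) (not_le.1 hr).le ⟨hR, hR'⟩).1

/-- Operators that satisfy the commutation relations of the matrix units `E i j` with `i < j`. -/
structure UpperTriangularAction (E : ℕ → ℕ → Module.End K V) : Prop where
  bracket : ∀ a b c v, a < b → b < c → E a b (E b c v) = E b c (E a b v) + E a c v
  comm : ∀ a b c d v, a < b → c < d → b ≠ c → d ≠ a → E a b (E c d v) = E c d (E a b v)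

/-- The vectors killed by all products of `s` operators `E i j` with `i < j`. -/
def killedBy (E : ℕ → ℕ → Module.End K V) (j : ℕ) : ℕ → V → Prop
  | 0, v => v = 0
  | s + 1, v => ∀ i < j, killedBy E j s (E i j v)

theorem killedBy_sub {E : ℕ → ℕ → Module.End K V} {j s : ℕ} {v w : V}
    (hv : killedBy E j s v) (hw : killedBy E j s w) : killedBy E j s (v - w) := by
  induction s generalizing v w with
  | zero => rw [killedBy] at *; rw [hv, hw, sub_zero]
  | succ s ih => intro i hi; rw [map_sub]; exact ih (hv i hi) (hw i hi)

/-- The commutator of `E a b` with `E i j` is `E a j` for `i = b` and zero otherwise, so `E a b` can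
be moved through a product of operators `E i j` without changing their number. -/
theorem killedBy_apply {E : ℕ → ℕ → Module.End K V} (hE : UpperTriangularAction E) {j a b : ℕ}
    (hab : a < b) (hb : b < j) {s : ℕ} {v : V} (hv : killedBy E j s v) :
    killedBy E j s (E a b v) := by
  induction s generalizing v with
  | zero => rw [killedBy] at *; rw [hv, map_zero]
  | succ s ih =>
    intro i hi
    by_cases h : b = i
    · subst h
      have := hE.bracket a b j v hab hb
      rw [← sub_eq_iff_eq_add] at this
      rw [← this]
      exact killedBy_sub (ih (hv b hi)) (hv a (hab.trans hb))
    · rw [← hE.comm a b i j v hab hi h (by omega)]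
      exact ih (hv i hi)

/-- The vectors obtained from `v` by applying operators `E a b` with `a < b ≤ j`, exactly `s` of
them with `b = j`. -/
inductive RaisingWord (E : ℕ → ℕ → Module.End K V) (v : V) (j : ℕ) : ℕ → V → Prop
  | base : RaisingWord E v j 0 v
  | lower {a b s w} : a < b → b < j → RaisingWord E v j s w → RaisingWord E v j s (E a b w)
  | last {a s w} : a < j → RaisingWord E v j s w → RaisingWord E v j (s + 1) (E a j w)

/-- Each factor `E a j` uses up one of the `M` steps, and the factors `E a b` with `b < j` cost
nothing. With truncated subtraction, `killedBy E j (M - s) w` says `w = 0` as soon as `M ≤ s`. -/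
theorem RaisingWord.eq_zero {E : ℕ → ℕ → Module.End K V} (hE : UpperTriangularAction E)
    {v : V} {j M : ℕ} (hv : killedBy E j M v) {s : ℕ} {w : V} (h : RaisingWord E v j s w)
    (hs : M ≤ s) : w = 0 := by
  have key : ∀ t, s + t = max M s → killedBy E j t w := by
    clear hs
    have aux : ∀ {s w}, RaisingWord E v j s w → killedBy E j (M - s) w := by
      intro s w h
      induction h with
      | base => exact hv
      | lower hab hb _ ih => exact killedBy_apply hE hab hb ih
      | @last a s w ha _ ih =>
        rcases Nat.lt_or_ge s M with h | h
        · obtain ⟨u, hu⟩ : ∃ u, M - s = u + 1 := ⟨M - s - 1, by omega⟩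
          rw [hu] at ih
          rw [show M - (s + 1) = u by omega]
          exact ih a ha
        · rw [Nat.sub_eq_zero_of_le h] at ih
          rw [Nat.sub_eq_zero_of_le (by omega)]
          change w = 0 at ih
          rw [ih, map_zero]
          rfl
    intro t ht
    rw [show t = M - s by omega]
    exact aux h
  exact key 0 (by omega)

theorem pow_apply_comm_of_comm {A B : Module.End K V} (h : ∀ v, A (B v) = B (A v)) (r : ℕ)
    (v : V) : (A ^ r) (B v) = B ((A ^ r) v) := by
  have : Commute A B := LinearMap.ext h
  exact LinearMap.congr_fun (this.pow_left r) v

theorem pow_apply_of_bracket {A B C : Module.End K V} (h : ∀ v, B (A v) = A (B v) + C v)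
    (hC : ∀ v, A (C v) = C (A v)) (r : ℕ) (v : V) :
    B ((A ^ (r + 1)) v) = (A ^ (r + 1)) (B v) + ((r : K) + 1) • (A ^ r) (C v) := by
  induction r with
  | zero => simp [h]
  | succ r ih =>
    have e : ∀ (m : ℕ) (x : V), A ((A ^ m) x) = (A ^ (m + 1)) x := fun m x => by
      rw [pow_succ', Module.End.mul_apply]
    rw [← e (r + 1) v, h, ih, map_add, map_smul, e, e, ← pow_apply_comm_of_comm hC (r + 1) v]
    push_cast
    module

/-- If `v` is killed by `E 0 1` and by the squares of `E j (j + 1)` for `1 ≤ j < m`, then it is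
killed by every product of `m` operators `E i m` with `i < m`. -/
theorem killedBy_of_simple_roots [CharZero K] {E : ℕ → ℕ → Module.End K V}
    (hE : UpperTriangularAction E) {v : V} (h0 : E 0 1 v = 0) {m : ℕ}
    (hsq : ∀ j, 1 ≤ j → j < m → (E j (j + 1) ^ 2) v = 0) (hm : 1 ≤ m) : killedBy E m m v := by
  induction m, hm using Nat.le_induction with
  | base =>
    intro i hi
    obtain rfl : i = 0 := by omega
    exact h0
  | succ j hj ih =>
    replace ih := ih fun i hi hij => hsq i hi (by omega)
    have hd := hsq j hj (by omega)
    -- Passing a factor `E a j` turns at most one `E j (j + 1)` into `E a (j + 1)`, so each such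
    -- factor raises the vanishing exponent, initially `2`, by at most one.
    have h1 : ∀ {s w}, RaisingWord E v j s w → ∀ r, 2 + s ≤ r → (E j (j + 1) ^ r) w = 0 := by
      intro s w hw
      induction hw with
      | base =>
        intro r hr
        obtain ⟨t, rfl⟩ := Nat.exists_eq_add_of_le' hr
        rw [add_zero, pow_add, Module.End.mul_apply, hd, map_zero]
      | @lower a b s w hab hb _ ihw =>
        intro r hr
        rw [pow_apply_comm_of_comm (fun x => hE.comm j (j + 1) a b x (by omega) hab (by omega)
          (by omega)), ihw r hr, map_zero]
      | @last a s w ha _ ihw =>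
        intro r hr
        obtain ⟨t, rfl⟩ : ∃ t, r = t + 1 := ⟨r - 1, by omega⟩
        have hC : ∀ x, E j (j + 1) (E a (j + 1) x) = E a (j + 1) (E j (j + 1) x) :=
          fun x => hE.comm j (j + 1) a (j + 1) x (by omega) (by omega) (by omega) (by omega)
        have := pow_apply_of_bracket (fun x => hE.bracket a j (j + 1) x ha (by omega)) hC t w
        rw [ihw (t + 1) (by omega), map_zero, pow_apply_comm_of_comm hC, ihw t (by omega),
          map_zero, smul_zero, add_zero] at this
        exact this.symm
    -- The bound becomes uniform: for `s ≥ j` the word already vanishes by the induction hypothesis.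
    have h2 : ∀ {s w}, RaisingWord E v j s w → ∀ r, j + 1 ≤ r → (E j (j + 1) ^ r) w = 0 := by
      intro s w hw r hr
      rcases Nat.lt_or_ge s j with h | h
      · exact h1 hw r (by omega)
      · rw [hw.eq_zero hE ih h, map_zero]
    -- The factors `E j (j + 1)` are traded one at a time for `E i (j + 1)`: apply `E i j` to a
    -- vanishing expression. The term in which it reaches `w` vanishes too, since `E i j w` is again
    -- a raising word, and the commutator term remains with coefficient `r + 1`.
    have h3 : ∀ l : List ℕ, (∀ i ∈ l, i < j) → ∀ {s w}, RaisingWord E v j s w →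
        ∀ r, j + 1 ≤ r + l.length →
          (E j (j + 1) ^ r) (l.foldr (fun i x => E i (j + 1) x) w) = 0 := by
      intro l
      induction l with
      | nil => intro _ s w hw r hr; exact h2 hw r hr
      | cons i l ihl =>
        intro hl s w hw r hr
        rw [List.forall_mem_cons] at hl
        have hcomm : ∀ l : List ℕ, (∀ i ∈ l, i < j) → ∀ w,
            E i j (l.foldr (fun i x => E i (j + 1) x) w)
              = l.foldr (fun i x => E i (j + 1) x) (E i j w) := by
          intro l
          induction l with
          | nil => intros; rfl
          | cons a l iha =>
            intro ha w
            rw [List.forall_mem_cons] at ha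
            rw [List.foldr_cons, List.foldr_cons, hE.comm i j a (j + 1) _ hl.1 (by omega)
              (by omega) (by omega), iha ha.2]
        have hC : ∀ x, E j (j + 1) (E i (j + 1) x) = E i (j + 1) (E j (j + 1) x) :=
          fun x => hE.comm j (j + 1) i (j + 1) x (by omega) (by omega) (by omega) (by omega)
        have := pow_apply_of_bracket (fun x => hE.bracket i j (j + 1) x hl.1 (by omega)) hC r
          (l.foldr (fun i x => E i (j + 1) x) w)
        rw [List.length_cons] at hr
        rw [ihl hl.2 hw (r + 1) (by omega), map_zero, hcomm l hl.2,
          ihl hl.2 (hw.last hl.1) (r + 1) (by omega), zero_add] at this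
        exact (smul_eq_zero.1 this.symm).resolve_left (by exact_mod_cast Nat.succ_ne_zero r)
    -- All operators with second index `j + 1` commute, so any product of `j + 1` of them can be
    -- sorted into a power of `E j (j + 1)` and a list of the others.
    have h4 : ∀ t, ∀ l : List ℕ, (∀ i ∈ l, i < j) → ∀ r, r + l.length + t = j + 1 →
        killedBy E (j + 1) t ((E j (j + 1) ^ r) (l.foldr (fun i x => E i (j + 1) x) v)) := by
      intro t
      induction t with
      | zero => intro l hl r hr; exact h3 l hl .base r (by omega)
      | succ t iht =>
        intro l hl r hr i hi
        rcases Nat.lt_succ_iff_lt_or_eq.1 hi with hi | rfl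
        · have hC : ∀ x, E j (j + 1) (E i (j + 1) x) = E i (j + 1) (E j (j + 1) x) :=
            fun x => hE.comm j (j + 1) i (j + 1) x (by omega) (by omega) (by omega) (by omega)
          rw [← pow_apply_comm_of_comm hC]
          exact iht (i :: l) (List.forall_mem_cons.2 ⟨hi, hl⟩) r (by rw [List.length_cons]; omega)
        · rw [← Module.End.mul_apply, ← pow_succ']
          exact iht l hl (r + 1) (by omega)
    exact h4 (j + 1) [] (by simp) 0 (by simp)

end RaisingOperators

/-! ### Polarization operators on polynomials in the entries of a matrix. -/

section Polarization

open MvPolynomial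

variable {K : Type*} [Field K] {C P : Type*}

/-- The derivation `∑ c, X (i, c) ∂ / ∂ X (j, c)` of the polynomial ring in the entries of a
matrix with rows indexed by `ℕ`. -/
noncomputable def polarization (i j : ℕ) :
    Derivation K (MvPolynomial (ℕ × C) K) (MvPolynomial (ℕ × C) K) :=
  mkDerivation K fun x => if x.1 = j then X (i, x.2) else 0

@[simp]
theorem polarization_X (i j : ℕ) (x : ℕ × C) :
    polarization i j (X x : MvPolynomial (ℕ × C) K) = if x.1 = j then X (i, x.2) else 0 :=
  mkDerivation_X _ _ _

theorem polarization_comm (i j k l : ℕ) (f : MvPolynomial (ℕ × C) K) :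
    polarization i j (polarization k l f) = polarization k l (polarization i j f)
      + (if j = k then polarization i l f else 0) - (if l = i then polarization k j f else 0) := by
  have h : ⁅(polarization i j : Derivation K (MvPolynomial (ℕ × C) K) _),
      (polarization k l : Derivation K (MvPolynomial (ℕ × C) K) _)⁆
      = (if j = k then polarization i l else 0) - (if l = i then polarization k j else 0) := by
    refine derivation_ext fun x => ?_
    rw [Derivation.commutator_apply]
    by_cases h1 : j = k <;> by_cases h2 : l = i <;> by_cases h3 : x.1 = l <;>
      by_cases h4 : x.1 = j <;> simp_all [eq_comm]
  have h' := DFunLike.congr_fun h f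
  rw [Derivation.commutator_apply, sub_eq_iff_eq_add] at h'
  rw [h', Derivation.sub_apply]
  split_ifs <;> (try simp only [Derivation.zero_apply]) <;> ring

theorem upperTriangularAction_polarization : UpperTriangularAction
    fun i j => (polarization i j : Derivation K (MvPolynomial (ℕ × C) K) _).toLinearMap where
  bracket a b c v hab hbc := by
    have := polarization_comm (K := K) a b b c v
    rw [if_pos rfl, if_neg (by omega), sub_zero] at this
    exact this
  comm a b c d v hab hcd hbc hda := by
    have := polarization_comm (K := K) a b c d v
    rw [if_neg hbc, if_neg hda, sub_zero, add_zero] at this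
    exact this

/-- Permutation of the rows of the matrix of variables. -/
noncomputable def rowPerm (σ : Equiv.Perm ℕ) :
    MvPolynomial (ℕ × C) K →ₐ[K] MvPolynomial (ℕ × C) K :=
  rename fun x => (σ x.1, x.2)

@[simp]
theorem rowPerm_X (σ : Equiv.Perm ℕ) (x : ℕ × C) :
    rowPerm σ (X x : MvPolynomial (ℕ × C) K) = X (σ x.1, x.2) :=
  rename_X _ _

theorem rowPerm_polarization (σ : Equiv.Perm ℕ) (i j : ℕ) (f : MvPolynomial (ℕ × C) K) :
    rowPerm σ (polarization i j f) = polarization (σ i) (σ j) (rowPerm σ f) := by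
  induction f using MvPolynomial.induction_on with
  | C a => simp [rowPerm, ← MvPolynomial.algebraMap_eq]
  | add f g hf hg => simp only [map_add, hf, hg]
  | mul_X f x hf =>
    simp only [Derivation.leibniz, map_add, map_mul, smul_eq_mul, hf, polarization_X, rowPerm_X,
      σ.injective.eq_iff]
    split_ifs <;> simp

theorem rowPerm_swap_rowPerm_swap (i j : ℕ) (f : MvPolynomial (ℕ × C) K) :
    rowPerm (Equiv.swap i j) (rowPerm (Equiv.swap i j) f) = f := by
  rw [rowPerm, rename_rename]
  convert rename_id_apply f
  ext x <;> simp

variable (K) in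
/-- The product of the variables in the rows `b a` and columns `γ a`. -/
noncomputable def cellMonomial [Fintype P] (b : P → ℕ) (γ : P → C) : MvPolynomial (ℕ × C) K :=
  ∏ a, X (b a, γ a)

theorem Derivation.map_finset_prod [DecidableEq P] {R A : Type*} [CommRing R] [CommRing A]
    [Algebra R A] (D : Derivation R A A) (s : Finset P) (f : P → A) :
    D (∏ a ∈ s, f a) = ∑ a ∈ s, (∏ b ∈ s.erase a, f b) * D (f a) := by
  induction s using Finset.induction_on with
  | empty => simp
  | insert a s ha ih =>
    rw [Finset.prod_insert ha, Derivation.leibniz, ih, Finset.sum_insert ha,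
      Finset.erase_insert ha, smul_eq_mul, smul_eq_mul, add_comm, Finset.mul_sum]
    congr 1
    refine Finset.sum_congr rfl fun b hb => ?_
    rw [Finset.erase_insert_of_ne (by rintro rfl; exact ha hb), Finset.prod_insert
      (fun h => ha (Finset.mem_of_mem_erase h)), mul_assoc]

theorem polarization_cellMonomial [Fintype P] [DecidableEq P] (i j : ℕ) (b : P → ℕ) (γ : P → C) :
    polarization i j (cellMonomial K b γ)
      = ∑ a with b a = j, cellMonomial K (Function.update b a i) γ := by
  rw [cellMonomial, Derivation.map_finset_prod, Finset.sum_filter]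
  refine Finset.sum_congr rfl fun a _ => ?_
  rw [polarization_X]
  split_ifs with h
  · rw [cellMonomial, ← Finset.prod_erase_mul _ _ (Finset.mem_univ a), Function.update_self]
    congr 1
    refine Finset.prod_congr rfl fun c hc => ?_
    rw [Function.update_of_ne (Finset.ne_of_mem_erase hc)]
  · rw [mul_zero]

theorem polarization_self_cellMonomial [Fintype P] [DecidableEq P] (i : ℕ) (b : P → ℕ) (γ : P → C) :
    polarization i i (cellMonomial K b γ)
      = ((Finset.univ.filter fun a => b a = i).card : K) • cellMonomial K b γ := by
  rw [polarization_cellMonomial, Finset.sum_congr rfl (g := fun _ => cellMonomial K b γ),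
    Finset.sum_const, Nat.cast_smul_eq_nsmul]
  intro a ha
  rw [← (Finset.mem_filter.1 ha).2, Function.update_eq_self]

/-- Every application moves one factor out of row `j`. This provides the nilpotency from which the
descents start. -/
theorem polarization_pow_cellMonomial [Fintype P] [DecidableEq P] {i j : ℕ} (hij : i ≠ j)
    (γ : P → C) {R : ℕ} {b : P → ℕ} (hR : (Finset.univ.filter fun a => b a = j).card < R) :
    ((polarization i j : Derivation K (MvPolynomial (ℕ × C) K) _).toLinearMap ^ R)
      (cellMonomial K b γ) = 0 := by
  induction R generalizing b with
  | zero => omega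
  | succ R ih =>
    rw [pow_succ, Module.End.mul_apply, Derivation.coeFn_coe, polarization_cellMonomial, map_sum]
    refine Finset.sum_eq_zero fun a ha => ih ?_
    refine lt_of_lt_of_le (Finset.card_lt_card ?_) (Nat.lt_succ_iff.1 hR)
    refine Finset.ssubset_iff_subset_ne.2 ⟨fun c hc => ?_, fun h => ?_⟩
    · rw [Finset.mem_filter] at hc ⊢
      by_cases hca : c = a
      · subst hca; simp [hij] at hc
      · simpa [hca] using hc
    · have := h.symm ▸ ha
      simp [hij] at this

theorem rowPerm_cellMonomial [Fintype P] (σ : Equiv.Perm ℕ) (b : P → ℕ) (γ : P → C) :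
    rowPerm σ (cellMonomial K b γ) = cellMonomial K (σ ∘ b) γ := by
  simp [cellMonomial, map_prod]

theorem cellMonomial_comp_perm [Fintype P] (b : P → ℕ) (γ : P → C) (π : Equiv.Perm P) :
    cellMonomial K (b ∘ π) (γ ∘ π) = cellMonomial K b γ :=
  Equiv.prod_comp π fun a => (X (b a, γ a) : MvPolynomial (ℕ × C) K)

theorem cellMonomial_eq_monomial [Fintype P] (b : P → ℕ) (γ : P → C) :
    cellMonomial K b γ = monomial (∑ a, Finsupp.single (b a, γ a) 1) 1 := by
  rw [cellMonomial, monomial_sum_one]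
  rfl

theorem polarization_eq_sum [Fintype C] (i j : ℕ) (f : MvPolynomial (ℕ × C) K) :
    polarization i j f = ∑ c, X (i, c) * pderiv (j, c) f := by
  classical
  have h : (polarization i j : Derivation K (MvPolynomial (ℕ × C) K) _)
      = ∑ c, (X (i, c) : MvPolynomial (ℕ × C) K) • pderiv (j, c) := by
    refine derivation_ext fun x => ?_
    rw [polarization_X, ← Derivation.coeFnAddMonoidHom_apply, map_sum, Finset.sum_apply]
    obtain ⟨r, d⟩ := x
    simp only [Derivation.coeFnAddMonoidHom_apply, Derivation.smul_apply, pderiv_X, smul_eq_mul]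
    by_cases h : r = j
    · subst h
      rw [Finset.sum_eq_single d] <;> simp +contextual [eq_comm]
    · simp [h]
  rw [h, ← Derivation.coeFnAddMonoidHom_apply, map_sum, Finset.sum_apply]
  rfl

/-- A polynomial in `m` columns, of degree at least `s` in the row `m`, vanishes if all
`s`-fold polarizations of the row `m` to the rows above do. -/
theorem eq_zero_of_killedBy_polarization [CharZero K] {m s q : ℕ} (hq : s ≤ q)
    {f : MvPolynomial (ℕ × Fin m) K} (hf : polarization m m f = (q : K) • f)
    (h : killedBy (fun i j => (polarization i j :
      Derivation K (MvPolynomial (ℕ × Fin m) K) _).toLinearMap) m s f) : f = 0 := by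
  induction s generalizing q f with
  | zero => exact h
  | succ s ih =>
    obtain ⟨q, rfl⟩ := Nat.exists_eq_add_of_le' (Nat.one_le_of_lt hq)
    -- Each polarization out of row `m` lowers the degree in that row by one and needs one operator
    -- fewer.
    have h1 : ∀ i < m, polarization i m f = 0 := by
      intro i hi
      refine ih (q := q) (by omega) ?_ (h i hi)
      rw [polarization_comm, if_neg (by omega), if_pos rfl, hf, Derivation.map_smul]
      push_cast
      module
    let A : Matrix (Fin m) (Fin m) (MvPolynomial (ℕ × Fin m) K) := fun i c => X (i, c)
    -- The generic matrix specializes to the identity.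
    have hA : A.det ≠ 0 := by
      intro h0
      have := congrArg (aeval fun x : ℕ × Fin m => if x.1 = x.2 then (1 : K) else 0) h0
      rw [AlgHom.map_det, map_zero] at this
      refine one_ne_zero (α := K) ?_
      rw [← this, ← Matrix.det_one (n := Fin m)]
      congr 1
      ext i c
      rw [AlgHom.mapMatrix_apply, Matrix.map_apply, Matrix.one_apply]
      simp [A, Fin.ext_iff]
    have h2 : A.mulVec (fun c => pderiv (m, c) f) = 0 := by
      funext i
      have := h1 i i.2
      rw [polarization_eq_sum] at this
      exact this
    have h3 : ∀ c, pderiv (m, c) f = 0 := by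
      have := Matrix.eq_zero_of_mulVec_eq_zero hA h2
      exact fun c => congrFun this c
    -- Euler's identity for row `m`: all its partial derivatives vanish, but the degree `q + 1` is
    -- positive.
    rw [polarization_eq_sum] at hf
    simp only [h3, mul_zero, Finset.sum_const_zero] at hf
    exact (smul_eq_zero.1 hf.symm).resolve_left (by exact_mod_cast Nat.succ_ne_zero q)

end Polarization

/-! ### Permutations preserving a partition, and positions in left-normed words. -/

section BlockPermutations

/-- Multiplying by the transposition of `a` and `τ a` shrinks the support, and this transposition
stays inside a fibre because `τ` does. -/
theorem Equiv.Perm.induction_of_preserving {α β : Type*} [Fintype α] [DecidableEq α] {f : α → β}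
    {p : Equiv.Perm α → Prop} (one : p 1)
    (swap_mul : ∀ a b τ, f a = f b → p τ → p (Equiv.swap a b * τ))
    {τ : Equiv.Perm α} (hτ : ∀ a, f (τ a) = f a) : p τ := by
  induction h : τ.support.card using Nat.strong_induction_on generalizing τ with
  | _ n ih =>
    by_cases h1 : τ = 1
    · rwa [h1]
    · obtain ⟨a, ha⟩ : ∃ a, τ a ≠ a := by
        by_contra! hc
        exact h1 (Equiv.ext hc)
      have h2 : p (Equiv.swap a (τ a) * τ) := by
        refine ih _ (h ▸ Equiv.Perm.card_support_swap_mul ha) (fun b => ?_) rfl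
        rw [Equiv.Perm.mul_apply, Equiv.apply_swap_eq_self (hτ a).symm, hτ]
      have := swap_mul a (τ a) _ (hτ a).symm h2
      rwa [← mul_assoc, Equiv.swap_mul_self, one_mul] at this

theorem exists_perm_comp_eq_of_sum_single_eq {α β : Type*} [Fintype α] {f g : α → β}
    (h : ∑ a, Finsupp.single (f a) 1 = ∑ a, Finsupp.single (g a) 1) :
    ∃ π : Equiv.Perm α, g = f ∘ π := by
  classical
  have key : ∀ x, Nonempty ({a // g a = x} ≃ {a // f a = x}) := by
    intro x
    have hx := DFunLike.congr_fun h x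
    simp only [Finsupp.finsetSum_apply, Finsupp.single_apply, Finset.sum_boole] at hx
    rw [← Fintype.card_eq, Fintype.card_subtype, Fintype.card_subtype]
    exact_mod_cast hx.symm
  refine ⟨Equiv.ofFiberEquiv fun x => (key x).some, ?_⟩
  funext a
  exact (Equiv.ofFiberEquiv_map _ a).symm

/-- The positions of the letters in a left-normed word with `k` brackets of arity `p + 1`: the
innermost letter, and `p` letters for each bracket. -/
abbrev CombPos (k p : ℕ) := Option (Fin k × Fin p)

/-- The bracket to which a position belongs. -/
def CombPos.block {k p : ℕ} : CombPos k p → ℕ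
  | none => 0
  | some x => x.1

/-- The exchange of the letters of two brackets. -/
def CombPos.blockSwap {k : ℕ} (p : ℕ) (i j : Fin k) : Equiv.Perm (CombPos k p) :=
  Equiv.optionCongr ((Equiv.swap i j).prodCongr (Equiv.refl _))

end BlockPermutations

/-! ### Generating polynomials and the relations between consecutive blocks. -/

section BlockRelations

open CombPos MvPolynomial

variable {K : Type*} [Field K] {k p m : ℕ}

theorem sum_block_eq {M : Type*} [AddCommMonoid M] (j : Fin k) (hj : 1 ≤ (j : ℕ))
    (f : CombPos k p → M) :
    ∑ a with block a = j, f a = ∑ i, f (some (j, i)) := by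
  have h : ∀ x c, (if block (some (x, c)) = j then f (some (x, c)) else 0)
      = if x = j then f (some (x, c)) else 0 := fun x c => if_congr Fin.val_inj rfl rfl
  rw [Finset.sum_filter, Fintype.sum_option, Fintype.sum_prod_type, if_neg (by simp [block]; omega),
    zero_add, Finset.sum_comm]
  simp only [h]
  simp

theorem sum_block_zero_eq {M : Type*} [AddCommMonoid M] (j : Fin k) (hj : (j : ℕ) = 0)
    (f : CombPos k p → M) :
    ∑ a with block a = 0, f a = f none + ∑ i, f (some (j, i)) := by
  have h : ∀ x c, (if block (some (x, c)) = 0 then f (some (x, c)) else 0)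
      = if x = j then f (some (x, c)) else 0 :=
    fun x c => if_congr (hj ▸ Fin.val_inj) rfl rfl
  rw [Finset.sum_filter, Fintype.sum_option, Fintype.sum_prod_type,
    if_pos (show block none = 0 from rfl), Finset.sum_comm]
  simp only [h]
  simp

theorem card_block_eq (j : Fin k) (hj : 1 ≤ (j : ℕ)) :
    (Finset.univ.filter fun a : CombPos k p => block a = j).card = p := by
  rw [Finset.card_eq_sum_ones, sum_block_eq j hj]
  simp

theorem card_block_zero_eq (j : Fin k) (hj : (j : ℕ) = 0) :
    (Finset.univ.filter fun a : CombPos k p => block a = 0).card = p + 1 := by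
  rw [Finset.card_eq_sum_ones, sum_block_zero_eq j hj]
  simp [add_comm]

/-- The generating polynomial of the values of `φ`, with the letters sorted by row `b` and
column `γ`. -/
noncomputable def genPoly {C P : Type*} [Fintype P] [DecidableEq P] (φ : Equiv.Perm P → K)
    (γ : P → C) (b : P → ℕ) : MvPolynomial (ℕ × C) K :=
  ∑ s, φ s • cellMonomial K b (γ ∘ s)

section genPoly

variable {C P : Type*} [Fintype P] [DecidableEq P] (φ : Equiv.Perm P → K) (γ : P → C)
  (b : P → ℕ)

/-- Translates of `φ` thus become rearrangements of the rows, which polarizations can express. -/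
theorem sum_mul_right_smul_cellMonomial (π : Equiv.Perm P) :
    ∑ s, φ (s * π) • cellMonomial K b (γ ∘ s) = genPoly φ γ (b ∘ π) := by
  rw [genPoly]
  refine Fintype.sum_equiv (Equiv.mulRight π) _ _ fun s => ?_
  rw [Equiv.coe_mulRight, ← cellMonomial_comp_perm b _ π]
  rfl

theorem polarization_genPoly (i j : ℕ) :
    polarization i j (genPoly φ γ b)
      = ∑ a with b a = j, genPoly φ γ (Function.update b a i) := by
  simp only [genPoly]
  rw [map_sum, Finset.sum_comm]
  refine Finset.sum_congr rfl fun s _ => ?_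
  rw [Derivation.map_smul, polarization_cellMonomial, Finset.smul_sum]

theorem polarization_self_genPoly (i : ℕ) :
    polarization i i (genPoly φ γ b)
      = ((Finset.univ.filter fun a => b a = i).card : K) • genPoly φ γ b := by
  simp only [genPoly]
  rw [map_sum, Finset.smul_sum]
  refine Finset.sum_congr rfl fun s _ => ?_
  rw [Derivation.map_smul, polarization_self_cellMonomial, smul_comm]

theorem polarization_pow_genPoly {i j : ℕ} (hij : i ≠ j) :
    ((polarization i j : Derivation K (MvPolynomial (ℕ × C) K) _).toLinearMap
      ^ (Fintype.card P + 1)) (genPoly φ γ b) = 0 := by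
  rw [genPoly, map_sum]
  refine Finset.sum_eq_zero fun s _ => ?_
  rw [map_smul, polarization_pow_cellMonomial hij _ (Nat.lt_succ_of_le (Finset.card_le_univ _)),
    smul_zero]

theorem rowPerm_genPoly (σ : Equiv.Perm ℕ) :
    rowPerm σ (genPoly φ γ b) = genPoly φ γ (σ ∘ b) := by
  simp only [genPoly, map_sum, map_smul, rowPerm_cellMonomial]

theorem genPoly_comp_swap {φ : Equiv.Perm P → K} {x y : P}
    (h : ∀ s, φ (s * Equiv.swap x y) = φ s) :
    genPoly φ γ (b ∘ Equiv.swap x y) = genPoly φ γ b := by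
  rw [← sum_mul_right_smul_cellMonomial, genPoly]
  simp only [h]

/-- A function that is invariant under the row permutations and the column permutations vanishes
if its generating polynomial does. -/
theorem eq_zero_of_genPoly_eq_zero [CharZero K] {φ : Equiv.Perm P → K} {γ : P → C} {b : P → ℕ}
    (hrow : ∀ x y, b x = b y → ∀ s, φ (s * Equiv.swap x y) = φ s)
    (hcol : ∀ q : Equiv.Perm P, (∀ a, γ (q a) = γ a) → ∀ s, φ (q * s) = φ s)
    (h : genPoly φ γ b = 0) (s : Equiv.Perm P) : φ s = 0 := by
  classical
  have hrow' : ∀ τ : Equiv.Perm P, (∀ a, b (τ a) = b a) → ∀ s, φ (s * τ) = φ s := by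
    intro τ hτ
    refine Equiv.Perm.induction_of_preserving (f := b) (p := fun τ => ∀ s, φ (s * τ) = φ s)
      (fun s => by rw [mul_one]) (fun x y τ hxy ih s => ?_) hτ
    rw [← mul_assoc, ih, hrow x y hxy]
  let d : Equiv.Perm P → (ℕ × C →₀ ℕ) := fun s => ∑ a, Finsupp.single (b a, γ (s a)) 1
  -- Arrangements with the same monomial differ by a column permutation on the left and a row
  -- permutation on the right. So the coefficient of that monomial is a positive multiple of `φ s`.
  have hd : ∀ t, d t = d s → φ t = φ s := by
    intro t ht
    obtain ⟨π, hπ⟩ := exists_perm_comp_eq_of_sum_single_eq ht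
    have hb : ∀ a, b (π a) = b a := fun a => (congrArg Prod.fst (congrFun hπ a)).symm
    have hγ : ∀ a, γ (t (π a)) = γ (s a) := fun a => (congrArg Prod.snd (congrFun hπ a)).symm
    rw [← hrow' π hb t, ← hcol (s * (t * π)⁻¹) _ (t * π), inv_mul_cancel_right]
    intro a
    obtain ⟨c, rfl⟩ := (t * π).surjective a
    rw [Equiv.Perm.mul_apply, Equiv.Perm.inv_def, Equiv.symm_apply_apply, ← hγ,
      Equiv.Perm.mul_apply]
  have h0 := congrArg (coeff (d s)) h
  rw [genPoly, coeff_sum, coeff_zero] at h0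
  have h1 : ∀ t, coeff (d s) (φ t • cellMonomial K b (γ ∘ t)) = if d t = d s then φ s else 0 := by
    intro t
    rw [coeff_smul, cellMonomial_eq_monomial, coeff_monomial, smul_eq_mul]
    change φ t * (if d t = d s then 1 else 0) = _
    split_ifs with ht
    · rw [mul_one, hd t ht]
    · rw [mul_zero]
  simp only [h1] at h0
  rw [← Finset.sum_filter, Finset.sum_const, nsmul_eq_mul] at h0
  refine (mul_eq_zero.1 h0).resolve_left (Nat.cast_ne_zero.2 ?_)
  exact Finset.card_ne_zero_of_mem (Finset.mem_filter.2 ⟨Finset.mem_univ s, rfl⟩)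

end genPoly

theorem sum_update_eq {P M : Type*} [Fintype P] [DecidableEq P] [AddCommMonoid M] {b : P → ℕ}
    {a : P} {v : ℕ} (hv : b a ≠ v) (f : P → M) :
    ∑ x with Function.update b a v x = v, f x = f a + ∑ x with b x = v, f x := by
  have : (Finset.univ.filter fun x => Function.update b a v x = v)
      = insert a (Finset.univ.filter fun x => b x = v) := by
    ext x
    by_cases h : x = a
    · subst h; simp
    · simp [h]
  rw [this, Finset.sum_insert (by simpa using hv)]

theorem update_update_eq_comp_swap {P : Type*} [DecidableEq P] {b : P → ℕ} {x y : P}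
    (hxy : x ≠ y) : Function.update (Function.update b x (b y)) y (b x) = b ∘ Equiv.swap x y := by
  funext z
  by_cases h1 : z = y
  · subst h1; simp
  · by_cases h2 : z = x
    · subst h2; simp [h1]
    · simp [h1, h2, Equiv.swap_apply_of_ne_of_ne]

theorem block_comp_blockSwap {i j : Fin k} (hi : 1 ≤ (i : ℕ)) (hj : 1 ≤ (j : ℕ)) :
    block ∘ blockSwap p i j = Equiv.swap (i : ℕ) j ∘ (block : CombPos k p → ℕ) := by
  funext a
  rcases a with _ | ⟨l, c⟩
  · change 0 = Equiv.swap (i : ℕ) j 0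
    rw [Equiv.swap_apply_of_ne_of_ne (by omega) (by omega)]
  · change ((Equiv.swap i j l : Fin k) : ℕ) = Equiv.swap (i : ℕ) j l
    simp only [Equiv.swap_apply_def, Fin.ext_iff]
    split_ifs <;> rfl

theorem block_comp_blockSwap_zero {i j : Fin k} (hi : (i : ℕ) = 0) (hj : (j : ℕ) = 1) :
    block ∘ blockSwap p i j
      = Function.update (Equiv.swap 0 1 ∘ (block : CombPos k p → ℕ)) none 0 := by
  funext a
  rcases a with _ | ⟨l, c⟩
  · simp [blockSwap, block]
  · rw [Function.update_of_ne (by simp)]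
    change ((Equiv.swap i j l : Fin k) : ℕ) = Equiv.swap 0 1 (l : ℕ)
    simp only [Equiv.swap_apply_def, Fin.ext_iff, hi, hj]
    split_ifs <;> simp [hi, hj]

variable [CharZero K] {C : Type*}

/-- Block `0` has `p + 1` letters and block `1` has `p`, so the generating polynomial has weight
`1`; the inner relation says that it is fixed by `E 0 1` after `E 1 0`. -/
theorem polarization_genPoly_zero_eq_zero {φ : Equiv.Perm (CombPos k p) → K} {γ : CombPos k p → C}
    (hrow : ∀ x y, block x = block y → ∀ s, φ (s * Equiv.swap x y) = φ s)
    {i j : Fin k} (hi : (i : ℕ) = 0) (hj : (j : ℕ) = 1)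
    (hinner : ∀ s, φ s = (-1) ^ p * (φ (s * blockSwap p i j)
      + ∑ c, φ (s * (Equiv.swap none (some (i, c)) * blockSwap p i j)))) :
    polarization 0 1 (genPoly φ γ block) = 0 := by
  have hεε : ((-1) ^ p * (-1) ^ p : K) = 1 := by
    rw [← mul_pow, neg_one_mul, neg_neg, one_pow]
  have h1 : genPoly φ γ block
      = ((-1) ^ p : K) • ((p + 1) • genPoly φ γ (block ∘ blockSwap p i j)) := by
    have h2 : ∀ c, genPoly φ γ (block ∘ (Equiv.swap none (some (i, c)) * blockSwap p i j :
        Equiv.Perm (CombPos k p))) = genPoly φ γ (block ∘ blockSwap p i j) := by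
      intro c
      congr 1
      funext a
      exact Equiv.apply_swap_eq_self (by simp [block, hi]) _
    conv_lhs => rw [genPoly]
    conv_lhs =>
      enter [2, s]
      rw [hinner, mul_smul, add_smul, Finset.sum_smul]
    rw [← Finset.smul_sum, Finset.sum_add_distrib, sum_mul_right_smul_cellMonomial,
      Finset.sum_comm]
    simp only [sum_mul_right_smul_cellMonomial, h2]
    rw [Finset.sum_const, Finset.card_univ, Fintype.card_fin, succ_nsmul']
  -- After the exchange of rows, row `1` holds `p + 1` letters. By row symmetry it does not matter
  -- which one is moved back to row `0`; moving back the innermost one gives the block exchange.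
  have h3 : polarization 0 1 (rowPerm (Equiv.swap 0 1) (genPoly φ γ block))
      = (p + 1) • genPoly φ γ (block ∘ blockSwap p i j) := by
    rw [rowPerm_genPoly, polarization_genPoly]
    have h4 : ∀ a : CombPos k p, (Equiv.swap 0 1 ∘ block) a = 1 ↔ block a = 0 := by
      intro a
      rw [Function.comp_apply, Equiv.swap_apply_eq_iff, Equiv.swap_apply_right]
    simp only [h4]
    rw [sum_block_zero_eq i hi, block_comp_blockSwap_zero hi hj, succ_nsmul']
    congr 1
    rw [Finset.sum_congr rfl (g := fun _ => genPoly φ γ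
      (Function.update (Equiv.swap 0 1 ∘ (block : CombPos k p → ℕ)) none 0)), Finset.sum_const,
      Finset.card_univ, Fintype.card_fin]
    intro c _
    rw [← genPoly_comp_swap γ _ (hrow none (some (i, c)) (by simp [block, hi]))]
    congr 1
    funext a
    by_cases h1 : a = none
    · subst h1; simp
    · by_cases h2 : a = some (i, c)
      · subst h2; simp [block, hi]
      · simp [h1, h2, Equiv.swap_apply_of_ne_of_ne]
  rw [← h3] at h1
  -- Applying the row exchange to the relation itself and substituting the result eliminates both
  -- the exchange and the sign.
  have h5 : rowPerm (Equiv.swap 0 1) (genPoly φ γ block)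
      = ((-1) ^ p : K) • polarization 1 0 (genPoly φ γ block) := by
    conv_lhs => rw [h1]
    rw [map_smul, rowPerm_polarization, rowPerm_swap_rowPerm_swap, Equiv.swap_apply_left,
      Equiv.swap_apply_right]
  rw [h5, Derivation.map_smul, smul_smul, hεε, one_smul] at h1
  refine raising_eq_zero_of_eq_raising_lowering
    (D := (polarization 0 1 : Derivation K (MvPolynomial (ℕ × C) K) _).toLinearMap)
    (U := (polarization 1 0 : Derivation K (MvPolynomial (ℕ × C) K) _).toLinearMap)
    (H := (polarization 0 0 : Derivation K (MvPolynomial (ℕ × C) K) _).toLinearMap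
      - (polarization 1 1 : Derivation K (MvPolynomial (ℕ × C) K) _).toLinearMap)
    (fun v => ?_) (fun v => ?_) ?_ h1 (polarization_pow_genPoly φ γ block zero_ne_one)
  · change polarization 0 1 (polarization 1 0 v) = polarization 1 0 (polarization 0 1 v)
      + (polarization 0 0 v - polarization 1 1 v)
    rw [polarization_comm, if_pos rfl, if_pos rfl]
    ring
  · change polarization 0 0 (polarization 0 1 v) - polarization 1 1 (polarization 0 1 v)
      = polarization 0 1 (polarization 0 0 v - polarization 1 1 v) + (2 : K) • polarization 0 1 v
    rw [polarization_comm, polarization_comm 1 1, map_sub]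
    simp only [one_ne_zero, if_true, if_false]
    module
  · change polarization 0 0 _ - polarization 1 1 _ = _
    have hc := card_block_eq (p := p) j hj.ge
    rw [hj] at hc
    rw [polarization_self_genPoly, polarization_self_genPoly, card_block_zero_eq i hi, hc]
    push_cast
    module

/-- Both blocks have `p` letters, so the weight is zero, and the block relation has the shape `v = ε
S v + D (U v)`. -/
theorem polarization_sq_genPoly_eq_zero {φ : Equiv.Perm (CombPos k p) → K} {γ : CombPos k p → C}
    {i j : Fin k} (hi : 1 ≤ (i : ℕ)) (hj : (j : ℕ) = i + 1)
    (hblock : ∀ s, φ s = (-1) ^ p * φ (s * blockSwap p i j) + p * φ s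
      + ∑ c, ∑ d, φ (s * Equiv.swap (some (i, c)) (some (j, d)))) :
    ((polarization i j : Derivation K (MvPolynomial (ℕ × C) K) _).toLinearMap ^ 2)
      (genPoly φ γ block) = 0 := by
  have hij : (i : ℕ) ≠ j := by omega
  have hεε : ((-1) ^ p * (-1) ^ p : K) = 1 := by
    rw [← mul_pow, neg_one_mul, neg_neg, one_pow]
  have h1 : genPoly φ γ block = ((-1) ^ p : K) • rowPerm (Equiv.swap (i : ℕ) j) (genPoly φ γ block)
      + polarization i j (polarization j i (genPoly φ γ block)) := by
    -- A letter moves from row `i` to row `j` and one moves back: either the same letter, in `p`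
    -- ways, or another one, which amounts to a transposition.
    have h2 : polarization i j (polarization j i (genPoly φ γ block)) = (p : K) • genPoly φ γ block
        + ∑ c, ∑ d, genPoly φ γ (block ∘ Equiv.swap (some (i, c)) (some (j, d))) := by
      rw [polarization_genPoly, map_sum, sum_block_eq i hi]
      simp only [polarization_genPoly]
      have h3 : ∀ c : Fin p,
          ∑ a with Function.update block (some (i, c)) (j : ℕ) a = j, genPoly φ γ
            (Function.update (Function.update block (some (i, c)) (j : ℕ)) a i)
          = genPoly φ γ block
            + ∑ d, genPoly φ γ (block ∘ Equiv.swap (some (i, c)) (some (j, d))) := by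
        intro c
        rw [sum_update_eq (a := some (i, c)) hij, sum_block_eq j (by omega), Function.update_idem]
        congr 1
        · congr 1
          exact Function.update_eq_self (some (i, c)) block
        · refine Finset.sum_congr rfl fun d _ => ?_
          rw [← update_update_eq_comp_swap]
          · rfl
          · intro h
            exact hij (congrArg block h)
      simp only [h3]
      rw [Finset.sum_add_distrib, Finset.sum_const, Finset.card_univ, Fintype.card_fin,
        Nat.cast_smul_eq_nsmul]
    rw [h2, rowPerm_genPoly, ← block_comp_blockSwap hi (by omega)]
    conv_lhs => rw [genPoly]
    conv_lhs =>
      enter [2, s]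
      rw [hblock, add_smul, add_smul, mul_smul, mul_smul, Finset.sum_smul]
      enter [2, 2, c]
      rw [Finset.sum_smul]
    rw [Finset.sum_add_distrib, Finset.sum_add_distrib, ← Finset.smul_sum, ← Finset.smul_sum,
      sum_mul_right_smul_cellMonomial, Finset.sum_comm, add_assoc]
    congr 2
    refine Finset.sum_congr rfl fun c _ => ?_
    rw [Finset.sum_comm]
    simp only [sum_mul_right_smul_cellMonomial]
  have hw : ∀ b : CombPos k p → ℕ, (Finset.univ.filter fun a => b a = i).card
      = (Finset.univ.filter fun a => b a = j).card →
      polarization (i : ℕ) i (genPoly φ γ b) - polarization (j : ℕ) j (genPoly φ γ b) = 0 := by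
    intro b hb
    rw [polarization_self_genPoly, polarization_self_genPoly, hb, sub_self]
  have hcard : (Finset.univ.filter fun a : CombPos k p => block a = i).card
      = (Finset.univ.filter fun a : CombPos k p => block a = j).card := by
    rw [card_block_eq i hi, card_block_eq j (by omega)]
  refine raising_sq_eq_zero_of_eq_swap_add
    (D := (polarization i j : Derivation K (MvPolynomial (ℕ × C) K) _).toLinearMap)
    (U := (polarization j i : Derivation K (MvPolynomial (ℕ × C) K) _).toLinearMap)
    (H := (polarization i i : Derivation K (MvPolynomial (ℕ × C) K) _).toLinearMap
      - (polarization j j : Derivation K (MvPolynomial (ℕ × C) K) _).toLinearMap)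
    (S := (rowPerm (Equiv.swap (i : ℕ) j)).toLinearMap)
    (fun v => ?_) (fun v => ?_) (fun v => ?_) (fun v => ?_)
    (rowPerm_swap_rowPerm_swap (i : ℕ) j) (hw block hcard) ?_ hεε h1
    (polarization_pow_genPoly φ γ block hij) ?_
  · change polarization _ _ (polarization _ _ v) = polarization _ _ (polarization _ _ v)
      + (polarization _ _ v - polarization _ _ v)
    rw [polarization_comm, if_pos rfl, if_pos rfl]
    ring
  · change polarization (i : ℕ) i (polarization (i : ℕ) j v)
        - polarization (j : ℕ) j (polarization (i : ℕ) j v)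
      = polarization (i : ℕ) j (polarization (i : ℕ) i v - polarization (j : ℕ) j v)
        + (2 : K) • polarization (i : ℕ) j v
    rw [polarization_comm, polarization_comm (j : ℕ) j, map_sub]
    simp only [hij.symm, if_true, if_false]
    module
  · change rowPerm _ (polarization _ _ v) = polarization _ _ (rowPerm _ v)
    rw [rowPerm_polarization, Equiv.swap_apply_left, Equiv.swap_apply_right]
  · change rowPerm _ (polarization _ _ v) = polarization _ _ (rowPerm _ v)
    rw [rowPerm_polarization, Equiv.swap_apply_left, Equiv.swap_apply_right]
  · change polarization (i : ℕ) i (rowPerm _ _) - polarization (j : ℕ) j (rowPerm _ _) = 0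
    rw [rowPerm_genPoly]
    refine hw _ ?_
    simp only [Function.comp_apply, Equiv.swap_apply_eq_iff, Equiv.swap_apply_left,
      Equiv.swap_apply_right]
    exact hcard.symm
  · rw [AlgHom.toLinearMap_apply, rowPerm_genPoly]
    exact polarization_pow_genPoly φ γ _ hij

/-- A function of the arrangements of the letters that satisfies the relations of left-normed
words with `m + 1` brackets and is invariant under the permutations of the letters within `m`
classes vanishes. -/
theorem eq_zero_of_block_relations {φ : Equiv.Perm (CombPos (m + 1) p) → K} (hm : 1 ≤ m)
    (hmp : m ≤ p) {γ : CombPos (m + 1) p → Fin m}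
    (hrow : ∀ x y, block x = block y → ∀ s, φ (s * Equiv.swap x y) = φ s)
    (hcol : ∀ q : Equiv.Perm (CombPos (m + 1) p), (∀ a, γ (q a) = γ a) → ∀ s, φ (q * s) = φ s)
    (hblock : ∀ i j : Fin (m + 1), (j : ℕ) = i + 1 → ∀ s,
      φ s = (-1) ^ p * φ (s * blockSwap p i j) + p * φ s
        + ∑ c, ∑ d, φ (s * Equiv.swap (some (i, c)) (some (j, d))))
    (hinner : ∀ i j : Fin (m + 1), (i : ℕ) = 0 → (j : ℕ) = 1 → ∀ s,
      φ s = (-1) ^ p * (φ (s * blockSwap p i j)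
        + ∑ c, φ (s * (Equiv.swap none (some (i, c)) * blockSwap p i j))))
    (s : Equiv.Perm (CombPos (m + 1) p)) : φ s = 0 := by
  refine eq_zero_of_genPoly_eq_zero (b := block) hrow hcol ?_ s
  have hlast := polarization_self_genPoly φ γ block m
  have hc := card_block_eq (p := p) (Fin.last m) hm
  rw [Fin.val_last] at hc
  rw [hc] at hlast
  -- The last row has degree `p`, and `m ≤ p` makes `m` polarizations out of it conclusive.
  refine eq_zero_of_killedBy_polarization hmp hlast ?_
  refine killedBy_of_simple_roots upperTriangularAction_polarization ?_ (fun j hj hjm => ?_) hm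
  · exact polarization_genPoly_zero_eq_zero hrow (i := 0) (j := ⟨1, by omega⟩) rfl rfl
      (hinner 0 ⟨1, by omega⟩ rfl rfl)
  · exact polarization_sq_genPoly_eq_zero (i := ⟨j, by omega⟩) (j := ⟨j + 1, by omega⟩) hj rfl
      (hblock ⟨j, by omega⟩ ⟨j + 1, by omega⟩ rfl)

end BlockRelations

/-! ### Identities in the free Filippov algebra and left-normed words. -/

section FilippovWords

variable {K : Type*} [Field K] {X : Type*}

variable (K) in
/-- The class of a word in the free Filippov algebra. -/
noncomputable def wordClass {n : ℕ} (w : BWord n X) : FreeFilippov K n X :=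
  Submodule.Quotient.mk (Finsupp.single w 1)

theorem filippovIdeal_le_comap_bracketAt {n : ℕ} (w : Fin n → BWord n X) (i : Fin n) :
    filippovIdeal K n X ≤ (filippovIdeal K n X).comap (bracketAt w i) :=
  Submodule.span_le.2 fun _ hr => Submodule.subset_span (FilippovRel.bracket w i hr)

/-- The linear map `u ↦ [w₁, …, wᵢ₋₁, u, wᵢ₊₁, …, wₙ]` on the free Filippov algebra. -/
noncomputable def quotBracketAt {n : ℕ} (w : Fin n → BWord n X) (i : Fin n) :
    FreeFilippov K n X →ₗ[K] FreeFilippov K n X :=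
  (filippovIdeal K n X).mapQ _ (bracketAt w i) (filippovIdeal_le_comap_bracketAt w i)

theorem quotBracketAt_wordClass {n : ℕ} (w : Fin n → BWord n X) (i : Fin n) (u : BWord n X) :
    quotBracketAt w i (wordClass K u) = wordClass K (.node (Function.update w i u)) := by
  rw [quotBracketAt, wordClass, Submodule.mapQ_apply, bracketAt, Finsupp.lmapDomain_apply,
    Finsupp.mapDomain_single]
  rfl

theorem wordClass_node_eq_sign_smul {n : ℕ} (σ : Equiv.Perm (Fin n)) (x : Fin n → BWord n X) :
    wordClass K (.node x) = ((Equiv.Perm.sign σ : ℤ) : K) • wordClass K (.node (x ∘ σ)) := by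
  refine (Submodule.Quotient.eq _).2 ?_
  exact Submodule.subset_span (FilippovRel.antisymm σ x)

theorem wordClass_node_comp_swap {n : ℕ} {a b : Fin n} (hab : a ≠ b) (x : Fin n → BWord n X) :
    wordClass K (.node (x ∘ Equiv.swap a b)) = -wordClass K (.node x) := by
  rw [wordClass_node_eq_sign_smul (Equiv.swap a b) x, Equiv.Perm.sign_swap hab]
  simp

namespace BWord

variable {p : ℕ}

/-- The word `[w, f₁, …, fₚ]`. -/
def bracketRight (w : BWord (p + 1) X) (f : Fin p → BWord (p + 1) X) : BWord (p + 1) X :=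
  node (Fin.cons w f)

theorem node_eq_bracketRight (c : Fin (p + 1) → BWord (p + 1) X) :
    node c = bracketRight (c 0) (Fin.tail c) := by
  rw [bracketRight, Fin.cons_self_tail]

end BWord

open BWord

variable {p : ℕ}

/-- The linear map `u ↦ [u, f₁, …, fₚ]` on the free Filippov algebra. -/
theorem exists_linearMap_bracketRight (w₀ : BWord (p + 1) X) (f : Fin p → BWord (p + 1) X) :
    ∃ T : FreeFilippov K (p + 1) X →ₗ[K] FreeFilippov K (p + 1) X,
      ∀ w, T (wordClass K w) = wordClass K (bracketRight w f) :=
  ⟨quotBracketAt (Fin.cons w₀ f) 0, fun w => by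
    rw [quotBracketAt_wordClass, Fin.update_cons_zero, bracketRight]⟩

theorem wordClass_jacobi (x : Fin (p + 1) → BWord (p + 1) X) (y : Fin p → BWord (p + 1) X) :
    wordClass K (bracketRight (node x) y)
      = ∑ i, wordClass K (node (Function.update x i (bracketRight (x i) y))) := by
  have := (Submodule.Quotient.eq (filippovIdeal K (p + 1) X)).2
    (Submodule.subset_span (FilippovRel.jacobi (K := K) 0 rfl x (Fin.cons (node x) y)))
  simp only [Fin.update_cons_zero] at this
  rw [wordClass, bracketRight, this, ← Submodule.mkQ_apply, map_sum]
  rfl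

theorem wordClass_bracketRight_swap (w : BWord (p + 1) X) (f : Fin p → BWord (p + 1) X)
    (a : Fin p) : wordClass K (bracketRight (f a) (Function.update f a w))
      = -wordClass K (bracketRight w f) := by
  rw [bracketRight, bracketRight, ← wordClass_node_comp_swap (Fin.succ_ne_zero a).symm]
  congr 2
  funext i
  refine Fin.cases ?_ (fun i => ?_) i
  · simp
  · by_cases h : i = a
    · subst h; simp
    · rw [Function.comp_apply, Equiv.swap_apply_of_ne_of_ne (Fin.succ_ne_zero i)
        (fun hi => h (Fin.succ_injective _ hi)), Fin.cons_succ, Fin.cons_succ,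
        Function.update_of_ne h]

theorem wordClass_bracketRight_comp_swap (w : BWord (p + 1) X) (f : Fin p → BWord (p + 1) X)
    {a b : Fin p} (hab : a ≠ b) : wordClass K (bracketRight w (f ∘ Equiv.swap a b))
      = -wordClass K (bracketRight w f) := by
  rw [bracketRight, bracketRight,
    ← wordClass_node_comp_swap (fun h => hab (Fin.succ_injective _ h) : a.succ ≠ b.succ)]
  congr 2
  funext i
  refine Fin.cases ?_ (fun i => ?_) i
  · rw [Function.comp_apply, Equiv.swap_apply_of_ne_of_ne (Fin.succ_ne_zero a).symm
      (Fin.succ_ne_zero b).symm]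
    rfl
  · rw [Function.comp_apply, ← (Fin.succ_injective p).map_swap]
    rfl

/-- The Jacobi identity with `[f a, g]` brought to the head of its bracket, which costs a sign. -/
theorem wordClass_bracketRight_bracketRight (w : BWord (p + 1) X) (f g : Fin p → BWord (p + 1) X) :
    wordClass K (bracketRight (bracketRight w f) g)
      = wordClass K (bracketRight (bracketRight w g) f)
        - ∑ a, wordClass K (bracketRight (bracketRight (f a) g) (Function.update f a w)) := by
  conv_lhs => rw [bracketRight, bracketRight]
  rw [← bracketRight, wordClass_jacobi, Fin.sum_univ_succ, Fin.update_cons_zero, sub_eq_add_neg,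
    ← Finset.sum_neg_distrib]
  congr 1
  refine Finset.sum_congr rfl fun a _ => ?_
  rw [Fin.cons_succ, ← Fin.cons_update, ← bracketRight]
  have := wordClass_bracketRight_swap (K := K) w
    (Function.update f a (bracketRight (f a) g)) a
  rw [Function.update_self, Function.update_idem] at this
  rw [this, neg_neg]

/-- A second use of the Jacobi identity on each `[[f a, g], …]` returns `w` to the innermost place,
so that only the entries of two consecutive brackets are rearranged. -/
theorem wordClass_bracketRight_exchange (w : BWord (p + 1) X) (f g : Fin p → BWord (p + 1) X) :
    wordClass K (bracketRight (bracketRight w f) g)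
      = wordClass K (bracketRight (bracketRight w g) f)
        + (p : K) • wordClass K (bracketRight (bracketRight w f) g)
        - ∑ a, ∑ b, wordClass K (bracketRight (bracketRight w (Function.update f a (g b)))
            (Function.update g b (f a))) := by
  have key : ∀ a, wordClass K (bracketRight (bracketRight (f a) g) (Function.update f a w))
      = -wordClass K (bracketRight (bracketRight w f) g)
        + ∑ b, wordClass K (bracketRight (bracketRight w (Function.update f a (g b)))
            (Function.update g b (f a))) := by
    intro a
    rw [wordClass_bracketRight_bracketRight, sub_eq_add_neg, ← Finset.sum_neg_distrib]
    congr 1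
    · obtain ⟨T, hT⟩ := exists_linearMap_bracketRight (K := K) w g
      rw [← hT, wordClass_bracketRight_swap, map_neg, hT]
    · refine Finset.sum_congr rfl fun b _ => ?_
      obtain ⟨T, hT⟩ := exists_linearMap_bracketRight (K := K) w (Function.update g b (f a))
      have := wordClass_bracketRight_swap (K := K) w (Function.update f a (g b)) a
      rw [Function.update_self, Function.update_idem] at this
      rw [← hT, this, map_neg, neg_neg, hT]
  conv_lhs => rw [wordClass_bracketRight_bracketRight]
  simp only [key]
  rw [Finset.sum_add_distrib, Finset.sum_const, Finset.card_univ, Fintype.card_fin,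
    ← Nat.cast_smul_eq_nsmul K, smul_neg]
  abel

/-- The words `[[[x, …], …], …]` in which only the first entry of a bracket may be a bracket. -/
inductive IsLeftNormed : BWord (p + 1) X → Prop
  | leaf (x : X) : IsLeftNormed (.leaf x)
  | bracket {w : BWord (p + 1) X} (r : Fin p → X) :
      IsLeftNormed w → IsLeftNormed (bracketRight w fun i => .leaf (r i))

section weight

variable {A : Type*} [AddCommMonoid A] {h : BWord (p + 1) X → A} {c : A}

/-- Additive weights cover the number of brackets (`c = 1`) and the multiset of letters (`c = 0`) at
once. -/
theorem weight_bracketRight (hh : ∀ w, h (node w) = c + ∑ i, h (w i)) (w : BWord (p + 1) X)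
    (f : Fin p → BWord (p + 1) X) : h (bracketRight w f) = c + (h w + ∑ i, h (f i)) := by
  rw [bracketRight, hh, Fin.sum_univ_succ]
  rfl

theorem weight_node_comp (hh : ∀ w, h (node w) = c + ∑ i, h (w i))
    (x : Fin (p + 1) → BWord (p + 1) X) (σ : Equiv.Perm (Fin (p + 1))) :
    h (node (x ∘ σ)) = h (node x) := by
  rw [hh, hh]
  congr 1
  exact Equiv.sum_comp σ fun i => h (x i)

theorem weight_jacobi_term (hh : ∀ w, h (node w) = c + ∑ i, h (w i))
    (x : Fin (p + 1) → BWord (p + 1) X) (y : Fin p → BWord (p + 1) X) (i : Fin (p + 1)) :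
    h (node (Function.update x i (bracketRight (x i) y))) = h (bracketRight (node x) y) := by
  rw [weight_bracketRight hh, hh, hh, ← Finset.add_sum_erase _ _ (Finset.mem_univ i),
    Function.update_self, weight_bracketRight hh,
    ← Finset.add_sum_erase _ (fun j => h (x j)) (Finset.mem_univ i),
    Finset.sum_congr rfl (g := fun j => h (x j))
      fun j hj => by rw [Function.update_of_ne (Finset.ne_of_mem_erase hj)]]
  abel

theorem weight_bracketRight_swap (hh : ∀ w, h (node w) = c + ∑ i, h (w i)) (w : BWord (p + 1) X)
    (f : Fin p → BWord (p + 1) X) (a : Fin p) :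
    h (bracketRight (f a) (Function.update f a w)) = h (bracketRight w f) := by
  rw [weight_bracketRight hh, weight_bracketRight hh,
    ← Finset.add_sum_erase _ _ (Finset.mem_univ a), Function.update_self,
    ← Finset.add_sum_erase _ (fun j => h (f j)) (Finset.mem_univ a),
    Finset.sum_congr rfl (g := fun j => h (f j))
      fun j hj => by rw [Function.update_of_ne (Finset.ne_of_mem_erase hj)]]
  abel

theorem weight_expansion_term (hh : ∀ w, h (node w) = c + ∑ i, h (w i)) (u : BWord (p + 1) X)
    (y : Fin p → BWord (p + 1) X) {a : Fin p} {x : Fin (p + 1) → BWord (p + 1) X}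
    (hx : y a = node x) (i : Fin (p + 1)) :
    h (bracketRight (bracketRight (x i) (Function.update y a u)) (Fin.tail
      (Function.update x i (bracketRight (x i) (Function.update y a u)) ∘ Equiv.swap 0 i)))
      = h (bracketRight u y) := by
  have hv0 : (Function.update x i (bracketRight (x i) (Function.update y a u))
      ∘ Equiv.swap 0 i) 0 = bracketRight (x i) (Function.update y a u) := by simp
  rw [← weight_bracketRight_swap hh u y a, hx, ← weight_jacobi_term hh x _ i,
    ← weight_node_comp hh _ (Equiv.swap 0 i), node_eq_bracketRight (_ ∘ _), hv0]

end weight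

theorem brackets_node (w : Fin (p + 1) → BWord (p + 1) X) :
    (node w).brackets = 1 + ∑ i, (w i).brackets := by
  rw [brackets]

theorem letters_node (w : Fin (p + 1) → BWord (p + 1) X) :
    (node w).letters = 0 + ∑ i, (w i).letters := by
  rw [letters, zero_add]

variable (K) in
/-- The span of the left-normed words with `k` brackets and the letters `S`. -/
noncomputable def leftNormedSpan (p k : ℕ) (S : Multiset X) :
    Submodule K (FreeFilippov K (p + 1) X) :=
  Submodule.span K {v | ∃ w : BWord (p + 1) X,
    IsLeftNormed w ∧ w.brackets = k ∧ w.letters = S ∧ v = wordClass K w}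

/-- A bracket `y a` outside the head is exchanged with the head and expanded by the Jacobi identity.
In each term the new bracket becomes the head, and the remaining entries are proper subwords of `y
a`. -/
theorem wordClass_mem_leftNormedSpan (w : BWord (p + 1) X) :
    wordClass K w ∈ leftNormedSpan K p w.brackets w.letters := by
  induction hk : w.brackets using Nat.strong_induction_on generalizing w with
  | _ k ih =>
    rcases w with x | c
    · exact Submodule.subset_span ⟨_, .leaf x, hk, rfl, rfl⟩
    -- Inner induction on the number `m` of brackets outside the head; when there are none, the
    -- outer induction applies to the head.
    · have key : ∀ m, ∀ (u : BWord (p + 1) X) (y : Fin p → BWord (p + 1) X),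
          ∑ i, (y i).brackets = m → (bracketRight u y).brackets = k →
          wordClass K (bracketRight u y) ∈ leftNormedSpan K p k (bracketRight u y).letters := by
        intro m
        induction m using Nat.strong_induction_on with
        | _ m ihm =>
          intro u y hm hk
          have hb := weight_bracketRight brackets_node u y
          by_cases hy : ∀ i, ∃ r, y i = leaf r
          · choose r hr using hy
            obtain rfl : y = fun i => leaf (r i) := funext hr
            have hu : u.brackets + 1 = k := by
              simp only [brackets, Finset.sum_const_zero] at hb
              omega
            obtain ⟨T, hT⟩ := exists_linearMap_bracketRight (K := K) u fun i => leaf (r i)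
            rw [← hT]
            have hu' := ih _ (by omega) u rfl
            have : leftNormedSpan K p u.brackets u.letters ≤ (leftNormedSpan K p k
                (bracketRight u fun i => leaf (r i)).letters).comap T := by
              refine Submodule.span_le.2 ?_
              rintro _ ⟨v, hv, hvk, hvS, rfl⟩
              rw [SetLike.mem_coe, Submodule.mem_comap, hT]
              refine Submodule.subset_span ⟨_, hv.bracket r, ?_, ?_, rfl⟩
              · rw [weight_bracketRight brackets_node, hvk, ← hk, hb]
              · rw [weight_bracketRight letters_node, weight_bracketRight letters_node, hvS]
            exact this hu'
          · push Not at hy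
            obtain ⟨a, ha⟩ := hy
            obtain ⟨x, hx⟩ : ∃ x, y a = node x := by
              rcases h : y a with r | x
              · exact absurd h (ha r)
              · exact ⟨x, rfl⟩
            have ham : (y a).brackets ≤ m :=
              hm ▸ Finset.single_le_sum (f := fun i => (y i).brackets) (fun _ _ => Nat.zero_le _)
                (Finset.mem_univ a)
            rw [← neg_neg (wordClass K (bracketRight u y)), ← wordClass_bracketRight_swap u y a,
              hx, wordClass_jacobi]
            refine Submodule.neg_mem _ (Submodule.sum_mem _ fun i _ => ?_)
            set Y := Function.update y a u with hY
            set v := Function.update x i (bracketRight (x i) Y) with hv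
            have hv0 : (v ∘ Equiv.swap 0 i) 0 = bracketRight (x i) Y := by simp [hv]
            have e2 := weight_expansion_term brackets_node u y hx i
            have e3 := weight_expansion_term letters_node u y hx i
            rw [← hY, ← hv] at e2 e3
            have e4 := weight_bracketRight brackets_node (bracketRight (x i) Y)
              (Fin.tail (v ∘ Equiv.swap 0 i))
            have e5 := weight_bracketRight brackets_node (x i) Y
            have e6 := weight_bracketRight_swap brackets_node u y a
            rw [← hY, weight_bracketRight brackets_node, hx] at e6
            rw [hx] at ham
            rw [wordClass_node_eq_sign_smul (Equiv.swap 0 i) v, node_eq_bracketRight, hv0]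
            refine Submodule.smul_mem _ _ ?_
            rw [← e3]
            -- The total is unchanged by `e2`; comparing it with `e4`, `e5` and `e6` leaves fewer
            -- brackets in the tail than in `node x`, hence fewer than `m`.
            exact ihm _ (by omega) _ _ rfl (e2.trans hk)
      rw [node_eq_bracketRight] at hk ⊢
      exact key _ _ _ rfl hk

end FilippovWords

/-! ### Left-normed words as arrangements of letters. -/

section CombWords

open BWord CombPos

variable {K : Type*} [Field K] {X : Type*} {p k : ℕ}

/-- The word obtained from `w` by bracketing with the rows `f j, …, f (j + d - 1)`. -/
def extendWord (f : ℕ → Fin p → X) (j : ℕ) : ℕ → BWord (p + 1) X → BWord (p + 1) X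
  | 0, w => w
  | d + 1, w => bracketRight (extendWord f j d w) fun i => .leaf (f (j + d) i)

theorem extendWord_congr {f g : ℕ → Fin p → X} {j d : ℕ} (h : ∀ l, j ≤ l → l < j + d → f l = g l)
    (w : BWord (p + 1) X) : extendWord f j d w = extendWord g j d w := by
  induction d with
  | zero => rfl
  | succ d ih =>
    rw [extendWord, extendWord, ih fun l hl hld => h l hl (by omega),
      h (j + d) (by omega) (by omega)]

theorem extendWord_add (f : ℕ → Fin p → X) (j d : ℕ) (w : BWord (p + 1) X) :
    extendWord f 0 (j + d) w = extendWord f j d (extendWord f 0 j w) := by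
  induction d with
  | zero => rfl
  | succ d ih => rw [← add_assoc, extendWord, extendWord, ih, zero_add]

theorem exists_linearMap_extendWord (w₀ : BWord (p + 1) X) (f : ℕ → Fin p → X) (j d : ℕ) :
    ∃ T : FreeFilippov K (p + 1) X →ₗ[K] FreeFilippov K (p + 1) X,
      ∀ w, T (wordClass K w) = wordClass K (extendWord f j d w) := by
  induction d with
  | zero => exact ⟨LinearMap.id, fun _ => rfl⟩
  | succ d ih =>
    obtain ⟨T, hT⟩ := ih
    obtain ⟨T', hT'⟩ := exists_linearMap_bracketRight (K := K) w₀ fun i => leaf (f (j + d) i)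
    exact ⟨T'.comp T, fun w => by rw [LinearMap.comp_apply, hT, hT', extendWord]⟩

/-- The letters of the brackets of a left-normed word. -/
def combRows (x : CombPos k p → X) (j : ℕ) (c : Fin p) : X :=
  if h : j < k then x (some (⟨j, h⟩, c)) else x none

/-- The left-normed word with `k` brackets whose letters are given by `x`. -/
def combWord (x : CombPos k p → X) : BWord (p + 1) X :=
  extendWord (combRows x) 0 k (.leaf (x none))

/-- The part of `combWord x` inside the bracket `j`. -/
def combInner (x : CombPos k p → X) (j : ℕ) : BWord (p + 1) X :=
  extendWord (combRows x) 0 j (.leaf (x none))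

theorem combRows_val (x : CombPos k p → X) (j : Fin k) :
    combRows x j = fun c => x (some (j, c)) := by
  funext c
  rw [combRows, dif_pos j.2]

theorem combInner_congr {x y : CombPos k p → X} {j : ℕ} (hj : j ≤ k) (h0 : x none = y none)
    (h : ∀ l : Fin k, (l : ℕ) < j → ∀ c, x (some (l, c)) = y (some (l, c))) :
    combInner x j = combInner y j := by
  rw [combInner, combInner, h0]
  refine extendWord_congr (fun l _ hl => ?_) _
  rw [combRows_val x ⟨l, by omega⟩, combRows_val y ⟨l, by omega⟩]
  funext c
  exact h ⟨l, by omega⟩ (by simpa using hl) c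

theorem combInner_succ (x : CombPos k p → X) (j : Fin k) :
    combInner x (j + 1) = bracketRight (combInner x j) fun c => .leaf (x (some (j, c))) := by
  rw [combInner, extendWord, zero_add, combRows_val]
  rfl

/-- The outer brackets act as one linear map depending only on their own letters, so identities for
inner brackets hold inside the whole word. -/
theorem exists_linearMap_combWord (x : CombPos k p → X) (j : Fin k) :
    ∃ T : FreeFilippov K (p + 1) X →ₗ[K] FreeFilippov K (p + 1) X, ∀ y : CombPos k p → X,
      (∀ l > j, ∀ c, y (some (l, c)) = x (some (l, c))) →
      wordClass K (combWord y)
        = T (wordClass K (bracketRight (combInner y j) fun c => .leaf (y (some (j, c))))) := by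
  obtain ⟨d, hd⟩ := Nat.exists_eq_add_of_le (Nat.succ_le_of_lt j.2)
  obtain ⟨T, hT⟩ := exists_linearMap_extendWord (K := K) (leaf (x none)) (combRows x) (j + 1) d
  refine ⟨T, fun y hy => ?_⟩
  rw [← combInner_succ, hT]
  congr 1
  have : combWord y = extendWord (combRows y) 0 (j + 1 + d) (.leaf (y none)) := by
    rw [combWord]
    congr
  rw [this, extendWord_add]
  refine extendWord_congr (fun l hl hld => ?_) _
  have hlk : l < k := by omega
  rw [combRows_val y ⟨l, hlk⟩, combRows_val x ⟨l, hlk⟩]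
  funext c
  exact hy ⟨l, hlk⟩ (Fin.lt_def.2 (by simp; omega)) c

theorem wordClass_combWord_comp_swap (x : CombPos k p → X) {a b : CombPos k p} (hab : a ≠ b)
    (hblock : block a = block b) :
    wordClass K (combWord (x ∘ Equiv.swap a b)) = -wordClass K (combWord x) := by
  have hnone : ∀ (x : CombPos k p → X) (l : Fin k) (c : Fin p), (l : ℕ) = 0 →
      wordClass K (combWord (x ∘ Equiv.swap none (some (l, c)))) = -wordClass K (combWord x) := by
    intro x l c hl
    obtain ⟨T, hT⟩ := exists_linearMap_combWord (K := K) x l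
    have hinner : ∀ y : CombPos k p → X, combInner y l = .leaf (y none) := by
      intro y
      rw [hl]
      rfl
    rw [hT x fun _ _ _ => rfl, hT _ ?_, ← map_neg, hinner, hinner,
      ← wordClass_bracketRight_swap _ _ c]
    · congr 3
      funext d
      by_cases h : d = c
      · subst h; simp
      · simp [h, Equiv.swap_apply_of_ne_of_ne]
    · intro m hm d
      rw [Function.comp_apply, Equiv.swap_apply_of_ne_of_ne (by simp)]
      simp only [ne_eq, Option.some.injEq, Prod.mk.injEq, not_and]
      intro h
      exact absurd h hm.ne'
  rcases a with _ | ⟨l, c⟩ <;> rcases b with _ | ⟨m, d⟩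
  · exact absurd rfl hab
  · exact hnone x m d hblock.symm
  · rw [Equiv.swap_comm]
    exact hnone x l c hblock
  · obtain rfl : l = m := Fin.ext hblock
    have hcd : c ≠ d := fun h => hab (by rw [h])
    obtain ⟨T, hT⟩ := exists_linearMap_combWord (K := K) x l
    rw [hT x fun _ _ _ => rfl, hT _ ?_, ← map_neg,
      ← wordClass_bracketRight_comp_swap _ _ hcd]
    · congr 3
      · refine combInner_congr l.2.le ?_ fun m hm e => ?_
        · rw [Function.comp_apply, Equiv.swap_apply_of_ne_of_ne (by simp) (by simp)]
        · have : m ≠ l := fun h => by simp [h] at hm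
          rw [Function.comp_apply, Equiv.swap_apply_of_ne_of_ne (by simp [this]) (by simp [this])]
      · funext e
        rw [Function.comp_apply, Function.comp_apply]
        have hinj : Function.Injective fun e : Fin p => (some (l, e) : CombPos k p) := by
          intro e e' h
          simpa using h
        have := (hinj.map_swap c d e).symm
        rw [this]
    · intro m hm e
      have : m ≠ l := hm.ne'
      rw [Function.comp_apply, Equiv.swap_apply_of_ne_of_ne (by simp [this]) (by simp [this])]

theorem wordClass_combWord_exchange (x : CombPos k p → X) {i j : Fin k} (hij : (j : ℕ) = i + 1) :
    wordClass K (combWord x) = wordClass K (combWord (x ∘ blockSwap p i j))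
      + (p : K) • wordClass K (combWord x)
      - ∑ c, ∑ d, wordClass K (combWord (x ∘ Equiv.swap (some (i, c)) (some (j, d)))) := by
  have hne : i ≠ j := fun h => by rw [h] at hij; omega
  obtain ⟨T, hT⟩ := exists_linearMap_combWord (K := K) x j
  have hT' : ∀ π : Equiv.Perm (CombPos k p),
      (∀ l, l ≠ i → l ≠ j → ∀ c, π (some (l, c)) = some (l, c)) →
      π none = none →
      wordClass K (combWord (x ∘ π)) = T (wordClass K (bracketRight (bracketRight (combInner x i)
        fun c => .leaf (x (π (some (i, c))))) fun c => .leaf (x (π (some (j, c)))))) := by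
    intro π hπ hπ0
    rw [hT, hij, combInner_succ]
    · congr 4
      refine combInner_congr i.2.le (by rw [Function.comp_apply, hπ0]) fun l hl c => ?_
      rw [Function.comp_apply, hπ l (Fin.ne_of_lt hl) (Fin.ne_of_lt (Fin.lt_def.2 (by omega)))]
    · intro l hl c
      rw [Function.comp_apply,
        hπ l (Fin.ne_of_gt (Fin.lt_def.2 (by have := Fin.lt_def.1 hl; omega))) hl.ne']
  have h1 := hT' 1 (fun _ _ _ _ => rfl) rfl
  simp only [Equiv.Perm.coe_one, Function.comp_id, id_eq] at h1
  have h2 := hT' (blockSwap p i j) (fun l hi hj c => by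
    simp [blockSwap, Equiv.swap_apply_of_ne_of_ne hi hj]) rfl
  have h3 : ∀ c d, wordClass K (combWord (x ∘ Equiv.swap (some (i, c)) (some (j, d)))) = _ :=
    fun c d => hT' (Equiv.swap (some (i, c)) (some (j, d)))
      (fun l hi hj e => Equiv.swap_apply_of_ne_of_ne (by simp [hi]) (by simp [hj]))
      (Equiv.swap_apply_of_ne_of_ne (by simp) (by simp))
  · rw [h2]
    simp only [h3]
    conv_lhs => rw [h1, wordClass_bracketRight_exchange]
    rw [map_sub, map_add, map_smul, ← h1]
    congr 1
    · congr 4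
      · congr 1
        funext c
        simp [blockSwap]
      · funext c
        simp [blockSwap]
    · rw [map_sum]
      refine Finset.sum_congr rfl fun c _ => ?_
      rw [map_sum]
      refine Finset.sum_congr rfl fun d _ => ?_
      congr 3
      · congr 1
        funext e
        by_cases h : e = c
        · subst h; simp
        · simp [h, Equiv.swap_apply_of_ne_of_ne, hne]
      · funext e
        by_cases h : e = d
        · subst h; simp
        · simp [h, Equiv.swap_apply_of_ne_of_ne, hne.symm]

/-- At the innermost bracket the head is a letter, so one application of the Jacobi identity already
gives left-normed words. -/
theorem wordClass_combWord_inner (x : CombPos k p → X) {i j : Fin k} (hi : (i : ℕ) = 0)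
    (hj : (j : ℕ) = 1) :
    wordClass K (combWord x) = wordClass K (combWord (x ∘ blockSwap p i j))
      - ∑ c, wordClass K (combWord
          (x ∘ (Equiv.swap none (some (i, c)) * blockSwap p i j : Equiv.Perm (CombPos k p)))) := by
  have hij : (j : ℕ) = i + 1 := by omega
  have hne : i ≠ j := fun h => by rw [h] at hij; omega
  obtain ⟨T, hT⟩ := exists_linearMap_combWord (K := K) x j
  have hT' : ∀ π : Equiv.Perm (CombPos k p),
      (∀ l, l ≠ i → l ≠ j → ∀ c, π (some (l, c)) = some (l, c)) →
      wordClass K (combWord (x ∘ π)) = T (wordClass K (bracketRight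
        (bracketRight (leaf (x (π none)))
        fun c => .leaf (x (π (some (i, c))))) fun c => .leaf (x (π (some (j, c)))))) := by
    intro π hπ
    rw [hT, hij, combInner_succ, hi]
    · rfl
    · intro l hl c
      rw [Function.comp_apply,
        hπ l (Fin.ne_of_gt (Fin.lt_def.2 (by have := Fin.lt_def.1 hl; omega))) hl.ne']
  have h1 := hT' 1 (fun _ _ _ _ => rfl)
  simp only [Equiv.Perm.coe_one, Function.comp_id, id_eq] at h1
  have hb : ∀ l, l ≠ i → l ≠ j → ∀ c, blockSwap p i j (some (l, c)) = some (l, c) := by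
    intro l hi hj c
    simp [blockSwap, Equiv.swap_apply_of_ne_of_ne hi hj]
  have h3 : ∀ c, wordClass K (combWord (x ∘ (Equiv.swap none (some (i, c)) * blockSwap p i j :
      Equiv.Perm (CombPos k p)))) = _ :=
    fun c => hT' (Equiv.swap none (some (i, c)) * blockSwap p i j) fun l hi hj d => by
      rw [Equiv.Perm.mul_apply, hb l hi hj, Equiv.swap_apply_of_ne_of_ne (by simp) (by simp [hi])]
  rw [hT' _ hb, h1, wordClass_bracketRight_bracketRight]
  simp only [h3]
  rw [map_sub, map_sum]
  congr 1
  · congr 3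
    · congr 1
      funext c
      simp [blockSwap]
    · funext c
      simp [blockSwap]
  · refine Finset.sum_congr rfl fun c _ => ?_
    congr 3
    · congr 1
      funext d
      simp [blockSwap, Equiv.swap_apply_of_ne_of_ne, hne.symm]
    · funext d
      by_cases h : d = c
      · subst h; simp [blockSwap]
      · simp [h, blockSwap, Equiv.swap_apply_of_ne_of_ne]

theorem sign_blockSwap {i j : Fin k} (hij : i ≠ j) :
    Equiv.Perm.sign (blockSwap p i j) = (-1) ^ p := by
  have : (Equiv.swap i j).prodCongr (Equiv.refl (Fin p))
      = Equiv.prodCongrLeft fun _ => Equiv.swap i j := rfl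
  rw [blockSwap, Equiv.optionCongr_sign, this, Equiv.Perm.sign_prodCongrLeft]
  simp [Equiv.Perm.sign_swap hij]

theorem IsLeftNormed.exists_eq_extendWord {w : BWord (p + 1) X} (h : IsLeftNormed w) :
    ∃ (f : ℕ → Fin p → X) (x : X), w = extendWord f 0 w.brackets (.leaf x) := by
  induction h with
  | leaf x => exact ⟨fun _ _ => x, x, rfl⟩
  | @bracket w r _ ih =>
    obtain ⟨f, x, hw⟩ := ih
    have hb : (bracketRight w fun i => BWord.leaf (r i)).brackets = w.brackets + 1 := by
      rw [weight_bracketRight brackets_node]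
      simp [brackets, add_comm]
    refine ⟨Function.update f w.brackets r, x, ?_⟩
    rw [hb, extendWord, zero_add, Function.update_self,
      extendWord_congr (g := f) fun l _ hl => Function.update_of_ne (by omega) _ _, ← hw]

theorem IsLeftNormed.exists_eq_combWord {w : BWord (p + 1) X} (h : IsLeftNormed w)
    (hk : w.brackets = k) : ∃ x : CombPos k p → X, w = combWord x := by
  obtain ⟨f, x, hw⟩ := h.exists_eq_extendWord
  refine ⟨fun a => a.elim x fun b => f b.1 b.2, ?_⟩
  rw [hw, hk, combWord]
  refine extendWord_congr (fun l _ hl => ?_) _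
  rw [combRows_val _ ⟨l, by omega⟩]
  rfl

theorem letters_extendWord (f : ℕ → Fin p → X) (d : ℕ) (w : BWord (p + 1) X) :
    (extendWord f 0 d w).letters = w.letters + ∑ j ∈ Finset.range d, ∑ c, {f j c} := by
  induction d with
  | zero => simp [extendWord]
  | succ d ih =>
    rw [extendWord, weight_bracketRight letters_node, ih, Finset.sum_range_succ]
    simp only [letters, zero_add, add_assoc]

theorem exists_eq_of_mem_letters_combWord {x : CombPos k p → X} {y : X}
    (hy : y ∈ (combWord x).letters) : ∃ a, x a = y := by
  rw [combWord, letters_extendWord, Multiset.mem_add, Multiset.mem_sum] at hy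
  rcases hy with hy | ⟨j, hj, hy⟩
  · exact ⟨none, (Multiset.mem_singleton.1 hy).symm⟩
  · obtain ⟨c, -, hc⟩ := Multiset.mem_sum.1 hy
    rw [combRows_val x ⟨j, Finset.mem_range.1 hj⟩] at hc
    exact ⟨_, (Multiset.mem_singleton.1 hc).symm⟩

theorem combWord_map {Y : Type*} (g : X → Y) (x : CombPos k p → X) :
    (combWord x).map g = combWord (g ∘ x) := by
  have : ∀ d, (extendWord (combRows x) 0 d (.leaf (x none))).map g
      = extendWord (combRows (g ∘ x)) 0 d (.leaf (g (x none))) := by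
    intro d
    induction d with
    | zero => rfl
    | succ d ih =>
      rw [extendWord, extendWord, bracketRight, bracketRight, BWord.map, ← ih]
      congr 1
      funext i
      refine Fin.cases rfl (fun i => ?_) i
      rw [Fin.cons_succ, Fin.cons_succ, BWord.map]
      unfold combRows
      split_ifs <;> rfl
  exact this k

end CombWords

/-! ### Symmetric and alternating vectors in the multilinear component. -/

section SymmetryTypes

open BWord CombPos

variable {K : Type*} [Field K] {X : Type*} {p k : ℕ}

/-- Averaging of a linear functional over the permutations that preserve `f`, with respect to a
character. -/
theorem exists_dual_equivariant [CharZero K] [Fintype X] [DecidableEq X] {β V : Type*}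
    [AddCommGroup V] [Module K V] (ρ : Representation K (Equiv.Perm X) V) (f : X → β)
    (χ : Equiv.Perm X →* ℤˣ) {v : V}
    (hv : ∀ q : Equiv.Perm X, (∀ a, f (q a) = f a) → ρ q v = ((χ q : ℤ) : K) • v)
    (l : V →ₗ[K] K) :
    ∃ l' : V →ₗ[K] K, (∀ q : Equiv.Perm X, (∀ a, f (q a) = f a) → ∀ w,
      l' (ρ q w) = ((χ q : ℤ) : K) * l' w) ∧ (l' v = 0 → l v = 0) := by
  classical
  have hχ : ∀ q, ((χ q : ℤ) : K) * ((χ q : ℤ) : K) = 1 := fun q => by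
    rw [← Int.cast_mul, ← Units.val_mul, Int.units_mul_self, Units.val_one, Int.cast_one]
  refine ⟨∑ q : Equiv.Perm X with ∀ a, f (q a) = f a, ((χ q : ℤ) : K) • l.comp (ρ q),
    fun q hq w => ?_, fun h => ?_⟩
  · simp only [LinearMap.sum_apply, LinearMap.smul_apply, LinearMap.comp_apply, smul_eq_mul]
    rw [Finset.mul_sum]
    refine Finset.sum_bij (fun r _ => r * q) ?_ (fun _ _ _ _ h => mul_right_cancel h) ?_ ?_
    · intro r hr
      simp only [Finset.mem_filter, Finset.mem_univ, true_and] at hr ⊢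
      intro a
      rw [Equiv.Perm.mul_apply, hr, hq]
    · intro r hr
      refine ⟨r * q⁻¹, ?_, inv_mul_cancel_right r q⟩
      simp only [Finset.mem_filter, Finset.mem_univ, true_and] at hr ⊢
      intro a
      obtain ⟨b, rfl⟩ := q.surjective a
      rw [Equiv.Perm.mul_apply, Equiv.Perm.inv_def, Equiv.symm_apply_apply, hr, hq]
    · intro r _
      rw [map_mul, map_mul, Module.End.mul_apply, Units.val_mul, Int.cast_mul]
      linear_combination -((χ r : ℤ) : K) * l (ρ r (ρ q w)) * hχ q
  · simp only [LinearMap.sum_apply, LinearMap.smul_apply, LinearMap.comp_apply, smul_eq_mul] at h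
    rw [Finset.sum_congr rfl (g := fun _ => l v), Finset.sum_const, nsmul_eq_mul] at h
    · refine (mul_eq_zero.1 h).resolve_left (Nat.cast_ne_zero.2 ?_)
      exact Finset.card_ne_zero_of_mem (a := 1) (by simp)
    · intro q hq
      rw [hv q (Finset.mem_filter.1 hq).2, map_smul, smul_eq_mul, ← mul_assoc, hχ, one_mul]

/-- Every letter occurs, so the arrangement is surjective; there are as many positions as letters,
so it is bijective. -/
theorem multilinearComponent_le_span [Fintype X] (hX : Fintype.card X = k * p + 1) :
    (multilinearComponent K (p + 1) X k).toSubmodule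
      ≤ Submodule.span K {v | ∃ x : CombPos k p ≃ X, v = wordClass K (combWord x)} := by
  refine Submodule.span_le.2 ?_
  rintro _ ⟨w, hk, hw, rfl⟩
  have h := wordClass_mem_leftNormedSpan (K := K) w
  rw [hk, hw] at h
  refine (Submodule.span_le.2 ?_ : leftNormedSpan K p k Finset.univ.val ≤ _) h
  rintro _ ⟨u, hu, huk, huS, rfl⟩
  obtain ⟨x, rfl⟩ := hu.exists_eq_combWord huk
  have hx : Function.Bijective x := by
    refine (Fintype.bijective_iff_surjective_and_card x).2 ⟨fun y => ?_, ?_⟩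
    · exact exists_eq_of_mem_letters_combWord (huS ▸ Finset.mem_univ y)
    · rw [hX, Fintype.card_option, Fintype.card_prod, Fintype.card_fin, Fintype.card_fin]
  exact Submodule.subset_span ⟨Equiv.ofBijective x hx, rfl⟩

theorem freeFilippovRep_wordClass_combWord (q : Equiv.Perm X) (x : CombPos k p → X) :
    freeFilippovRep K (p + 1) X q (wordClass K (combWord x)) = wordClass K (combWord (q ∘ x)) := by
  rw [wordClass, freeFilippovRep_mk_single, combWord_map]
  rfl

/-- To prove that a vector of the multilinear component vanishes, it is enough to consider
functionals with the same symmetry on left-normed words. -/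
theorem eq_zero_of_dual_combWord [CharZero K] [Fintype X] [DecidableEq X] {β : Type*}
    (hX : Fintype.card X = k * p + 1) (f : X → β) (χ : Equiv.Perm X →* ℤˣ)
    {v : FreeFilippov K (p + 1) X} (hvm : v ∈ (multilinearComponent K (p + 1) X k).toSubmodule)
    (hv : ∀ q : Equiv.Perm X, (∀ a, f (q a) = f a) →
      freeFilippovRep K (p + 1) X q v = ((χ q : ℤ) : K) • v)
    (h : ∀ l : FreeFilippov K (p + 1) X →ₗ[K] K,
      (∀ q : Equiv.Perm X, (∀ a, f (q a) = f a) → ∀ x : CombPos k p → X,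
        l (wordClass K (combWord (q ∘ x))) = ((χ q : ℤ) : K) * l (wordClass K (combWord x))) →
      ∀ x : CombPos k p ≃ X, l (wordClass K (combWord x)) = 0) : v = 0 := by
  refine (Module.forall_dual_apply_eq_zero_iff K v).1 fun l => ?_
  obtain ⟨l', hl', hlv⟩ := exists_dual_equivariant (freeFilippovRep K (p + 1) X) f χ hv l
  refine hlv ?_
  have : Submodule.span K {v | ∃ x : CombPos k p ≃ X, v = wordClass K (combWord x)}
      ≤ LinearMap.ker l' := by
    refine Submodule.span_le.2 ?_
    rintro _ ⟨x, rfl⟩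
    refine h l' (fun q hq x => ?_) x
    rw [← freeFilippovRep_wordClass_combWord, hl' q hq]
  exact this (multilinearComponent_le_span hX hvm)

/-- The multilinear component with `k` brackets has no nonzero vector that is symmetric in more
than `k` letters. -/
theorem eq_zero_of_symmetric [CharZero K] [Fintype X] [DecidableEq X] {β : Type*}
    (hX : Fintype.card X = k * p + 1) (hk : 1 ≤ k) (f : X → β)
    {R : Finset X} (hR : k < R.card) (hf : ∀ a ∈ R, ∀ b ∈ R, f a = f b)
    {v : FreeFilippov K (p + 1) X} (hvm : v ∈ (multilinearComponent K (p + 1) X k).toSubmodule)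
    (hv : ∀ q : Equiv.Perm X, (∀ a, f (q a) = f a) → freeFilippovRep K (p + 1) X q v = v) :
    v = 0 := by
  refine eq_zero_of_dual_combWord hX f 1 hvm (fun q hq => by rw [hv q hq]; simp)
    fun l hl x => ?_
  have hblock : ∀ a : CombPos k p, block a < k := by
    rintro (_ | ⟨i, c⟩)
    · exact hk
    · exact i.2
  -- Pigeonhole: two letters of `R` share a block, so exchanging them both preserves and negates the
  -- value of `l`.
  obtain ⟨a, ha, b, hb, hab, hblk⟩ := Finset.exists_ne_map_eq_of_card_lt_of_maps_to
    (s := R) (t := Finset.range k) (by rwa [Finset.card_range])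
    (f := fun y => block (x.symm y)) (fun y _ => Finset.mem_range.2 (hblock _))
  have h1 := hl (Equiv.swap a b) (fun c => Equiv.apply_swap_eq_self (hf a ha b hb) c) x
  have h2 : (Equiv.swap a b : X → X) ∘ x = x ∘ Equiv.swap (x.symm a) (x.symm b) := by
    funext c
    rw [Function.comp_apply, Function.comp_apply, x.injective.map_swap]
    simp
  rw [h2, wordClass_combWord_comp_swap _ (fun h => hab (x.symm.injective h)) hblk, map_neg] at h1
  simpa [neg_eq_iff_add_eq_zero, ← two_mul] using h1

/-- The multilinear component with `m + 1` brackets of arity `p + 1 > m` has no nonzero vector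
that is alternating in the letters of each of `m` classes. -/
theorem eq_zero_of_alternating [CharZero K] [Fintype X] [DecidableEq X] {m : ℕ}
    (hX : Fintype.card X = (m + 1) * p + 1) (hmp : m ≤ p) (f : X → Fin m)
    {v : FreeFilippov K (p + 1) X}
    (hvm : v ∈ (multilinearComponent K (p + 1) X (m + 1)).toSubmodule)
    (hv : ∀ q : Equiv.Perm X, (∀ a, f (q a) = f a) →
      freeFilippovRep K (p + 1) X q v = ((Equiv.Perm.sign q : ℤ) : K) • v) : v = 0 := by
  refine eq_zero_of_dual_combWord hX f Equiv.Perm.sign hvm hv fun l hl x => ?_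
  -- For `m = 0` there is no map from the nonempty set of letters to the classes.
  have hm : 1 ≤ m := by
    rcases m with _ | m
    · exact (f (x none)).elim0
    · omega
  -- The sign turns alternation, both in blocks and in classes, into invariance. A block exchange
  -- consists of `p` transpositions, whence the factors `(-1) ^ p`.
  let φ : Equiv.Perm (CombPos (m + 1) p) → K := fun s =>
    ((Equiv.Perm.sign s : ℤ) : K) * l (wordClass K (combWord (x ∘ s)))
  have hφ : ∀ s π : Equiv.Perm (CombPos (m + 1) p), φ (s * π) = ((Equiv.Perm.sign π : ℤ) : K) *
      (((Equiv.Perm.sign s : ℤ) : K) * l (wordClass K (combWord ((x ∘ s) ∘ π)))) := by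
    intro s π
    simp only [φ, map_mul, Units.val_mul, Int.cast_mul]
    rw [mul_comm ((Equiv.Perm.sign s : ℤ) : K), mul_assoc]
    rfl
  have hswap : ∀ (s : Equiv.Perm (CombPos (m + 1) p)) {a b}, a ≠ b →
      φ (s * Equiv.swap a b)
        = -(((Equiv.Perm.sign s : ℤ) : K) * l (wordClass K (combWord ((x ∘ s) ∘ Equiv.swap a b)))) := by
    intro s a b hab
    rw [hφ, Equiv.Perm.sign_swap hab]
    simp
  have hε : ((-1) ^ p * (-1) ^ p : K) = 1 := by
    rw [← mul_pow, neg_one_mul, neg_neg, one_pow]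
  have hblk : ∀ (s : Equiv.Perm (CombPos (m + 1) p)) {i j : Fin (m + 1)}, i ≠ j →
      (-1) ^ p * φ (s * blockSwap p i j) = ((Equiv.Perm.sign s : ℤ) : K) *
        l (wordClass K (combWord ((x ∘ s) ∘ blockSwap p i j))) := by
    intro s i j hij
    rw [hφ, sign_blockSwap hij, ← mul_assoc]
    push_cast
    rw [hε, one_mul]
  have := eq_zero_of_block_relations (φ := φ) hm hmp (γ := fun a => f (x a)) ?_ ?_ ?_ ?_ 1
  · simpa [φ] using this
  · intro a b hab s
    by_cases h : a = b
    · rw [h, Equiv.swap_self]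
      rfl
    · rw [hswap s h, wordClass_combWord_comp_swap _ h hab, map_neg, mul_neg, neg_neg]
  · intro q hq s
    have h1 : (x ∘ (q * s : Equiv.Perm (CombPos (m + 1) p)) : _ → X)
        = (x.permCongr q) ∘ (x ∘ s) := by
      funext a
      simp
    have h2 := hl (x.permCongr q) (fun a => by simpa using hq (x.symm a)) (x ∘ s)
    simp only [φ]
    rw [h1, h2, Equiv.Perm.sign_permCongr, map_mul, Units.val_mul, Int.cast_mul,
      mul_comm ((Equiv.Perm.sign q : ℤ) : K), mul_assoc, ← mul_assoc _ _ (l _), ← Int.cast_mul,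
      ← Units.val_mul, Int.units_mul_self]
    simp
  · intro i j hij s
    have hne : i ≠ j := fun h => by rw [h] at hij; omega
    rw [hblk s hne]
    simp only [hswap s (show some (i, _) ≠ some (j, _) by simp [hne])]
    simp only [φ]
    conv_lhs => rw [wordClass_combWord_exchange _ hij]
    rw [map_sub, map_add, map_smul, map_sum]
    simp only [map_sum, Finset.sum_neg_distrib, ← Finset.mul_sum, smul_eq_mul]
    ring
  · intro i j hi hj s
    have hne : i ≠ j := fun h => by rw [h] at hi; omega
    have h3 : ∀ c, (-1) ^ p * φ (s * (Equiv.swap none (some (i, c)) * blockSwap p i j))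
        = -(((Equiv.Perm.sign s : ℤ) : K) * l (wordClass K (combWord ((x ∘ s) ∘
          (Equiv.swap none (some (i, c)) * blockSwap p i j :
            Equiv.Perm (CombPos (m + 1) p)))))) := by
      intro c
      rw [hφ, map_mul, sign_blockSwap hne, Equiv.Perm.sign_swap (by simp), ← mul_assoc]
      push_cast
      rw [neg_one_mul, mul_neg, hε, neg_one_mul]
    rw [mul_add, Finset.mul_sum, hblk s hne]
    simp only [h3]
    simp only [φ]
    conv_lhs => rw [wordClass_combWord_inner _ hi hj]
    rw [map_sub, map_sum]
    simp only [Finset.sum_neg_distrib, ← Finset.mul_sum]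
    ring

end SymmetryTypes

/-! ### Antisymmetrizers. -/

section Alternators

variable {K : Type*} [Field K] {N : ℕ}

/-- The antisymmetrizer of the group of permutations that preserve `f`. -/
noncomputable def alternator {V : Type*} [AddCommGroup V] [Module K V]
    (ρ : Representation K (Equiv.Perm (Fin N)) V) (f : Fin N → ℕ) : V →ₗ[K] V :=
  ∑ q : Equiv.Perm (Fin N) with ∀ i, f (q i) = f i, ((Equiv.Perm.sign q : ℤ) : K) • ρ q

section general

variable {V V' : Type*} [AddCommGroup V] [Module K V] [AddCommGroup V'] [Module K V']
  {ρ : Representation K (Equiv.Perm (Fin N)) V} {ρ' : Representation K (Equiv.Perm (Fin N)) V'}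
  {f : Fin N → ℕ}

theorem alternator_apply (v : V) : alternator ρ f v
    = ∑ q : Equiv.Perm (Fin N) with ∀ i, f (q i) = f i, ((Equiv.Perm.sign q : ℤ) : K) • ρ q v := by
  rw [alternator, LinearMap.sum_apply]
  rfl

theorem sign_mul_sign_cast (q : Equiv.Perm (Fin N)) :
    ((Equiv.Perm.sign q : ℤ) : K) * ((Equiv.Perm.sign q : ℤ) : K) = 1 := by
  rw [← Int.cast_mul, ← Units.val_mul, Int.units_mul_self, Units.val_one, Int.cast_one]

theorem preserves_inv {q : Equiv.Perm (Fin N)} (hq : ∀ i, f (q i) = f i) (i : Fin N) :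
    f (q⁻¹ i) = f i := by
  rw [← hq, Equiv.Perm.inv_def, Equiv.apply_symm_apply]

theorem alternator_rep_apply {q : Equiv.Perm (Fin N)} (hq : ∀ i, f (q i) = f i) (v : V) :
    alternator ρ f (ρ q v) = ((Equiv.Perm.sign q : ℤ) : K) • alternator ρ f v := by
  rw [alternator_apply, alternator_apply, Finset.smul_sum]
  refine Finset.sum_bij (fun r _ => r * q) ?_ (fun _ _ _ _ h => mul_right_cancel h) ?_ ?_
  · intro r hr
    simp only [Finset.mem_filter, Finset.mem_univ, true_and] at hr ⊢
    intro a
    rw [Equiv.Perm.mul_apply, hr, hq]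
  · intro r hr
    refine ⟨r * q⁻¹, ?_, inv_mul_cancel_right r q⟩
    simp only [Finset.mem_filter, Finset.mem_univ, true_and] at hr ⊢
    intro a
    rw [Equiv.Perm.mul_apply, hr, preserves_inv hq]
  · intro r _
    rw [smul_smul, map_mul, map_mul, Module.End.mul_apply, Units.val_mul, Int.cast_mul, mul_comm,
      mul_assoc, sign_mul_sign_cast, mul_one]

theorem rep_alternator_apply {q : Equiv.Perm (Fin N)} (hq : ∀ i, f (q i) = f i) (v : V) :
    ρ q (alternator ρ f v) = ((Equiv.Perm.sign q : ℤ) : K) • alternator ρ f v := by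
  rw [alternator_apply, map_sum, Finset.smul_sum]
  refine Finset.sum_bij (fun r _ => q * r) ?_ (fun _ _ _ _ h => mul_left_cancel h) ?_ ?_
  · intro r hr
    simp only [Finset.mem_filter, Finset.mem_univ, true_and] at hr ⊢
    intro a
    rw [Equiv.Perm.mul_apply, hq, hr]
  · intro r hr
    refine ⟨q⁻¹ * r, ?_, mul_inv_cancel_left q r⟩
    simp only [Finset.mem_filter, Finset.mem_univ, true_and] at hr ⊢
    intro a
    rw [Equiv.Perm.mul_apply, preserves_inv hq, hr]
  · intro r _
    rw [smul_smul, map_mul, map_mul, Module.End.mul_apply, Units.val_mul, Int.cast_mul,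
      ← mul_assoc, sign_mul_sign_cast, one_mul, map_smul]

theorem alternator_alternator (v : V) : ∃ c : ℕ, c ≠ 0 ∧
    alternator ρ f (alternator ρ f v) = (c : K) • alternator ρ f v := by
  refine ⟨(Finset.univ.filter fun q : Equiv.Perm (Fin N) => ∀ i, f (q i) = f i).card,
    Finset.card_ne_zero_of_mem (a := 1) (by simp), ?_⟩
  rw [alternator_apply (alternator ρ f v), Finset.sum_congr rfl (g := fun _ => alternator ρ f v),
    Finset.sum_const, Nat.cast_smul_eq_nsmul]
  intro q hq
  rw [rep_alternator_apply (Finset.mem_filter.1 hq).2, smul_smul, sign_mul_sign_cast, one_smul]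

theorem map_alternator (φ : ρ.IntertwiningMap ρ') (v : V) :
    φ (alternator ρ f v) = alternator ρ' f (φ v) := by
  rw [alternator_apply, alternator_apply, map_sum]
  refine Finset.sum_congr rfl fun q _ => ?_
  rw [map_smul, φ.isIntertwining]

theorem coe_alternator (U : Subrepresentation ρ) (v : U.toSubmodule) :
    (alternator U.toRepresentation f v : V) = alternator ρ f v := by
  rw [alternator_apply, alternator_apply, AddSubmonoidClass.coe_finsetSum]
  rfl

end general

end Alternators

/-! ### Tabloids and the dominance order. -/

section Tabloids

variable {K : Type*} [Field K] {N : ℕ} {μ ν : YoungDiagram}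

theorem exists_perm_comp_eq_of_card_eq {α β : Type*} [Fintype α] [DecidableEq β] {f g : α → β}
    (h : ∀ x, (Finset.univ.filter fun a => f a = x).card
      = (Finset.univ.filter fun a => g a = x).card) :
    ∃ π : Equiv.Perm α, g = f ∘ π := by
  refine exists_perm_comp_eq_of_sum_single_eq (Finsupp.ext fun x => ?_)
  simp only [Finsupp.finsetSum_apply, Finsupp.single_apply, Finset.sum_boole, h]

/-- The number of cells in the first `r` rows. -/
def YoungDiagram.cellsAbove (μ : YoungDiagram) (r : ℕ) : ℕ :=
  (μ.cells.filter fun c => c.1 < r).card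

theorem YoungDiagram.cellsAbove_succ (μ : YoungDiagram) (r : ℕ) :
    μ.cellsAbove (r + 1) = μ.cellsAbove r + μ.rowLen r := by
  rw [cellsAbove, cellsAbove, rowLen_eq_card, row, ← Finset.card_union_of_disjoint]
  · congr 1
    ext c
    simp only [Finset.mem_filter, Finset.mem_union, Nat.lt_succ_iff_lt_or_eq]
    tauto
  · rw [Finset.disjoint_filter]
    intro c _ h
    exact h.ne

theorem YoungDiagram.eq_of_cellsAbove_eq (h : ∀ r, μ.cellsAbove r = ν.cellsAbove r) : μ = ν := by
  have hrow : ∀ r, μ.rowLen r = ν.rowLen r := fun r => by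
    have h1 := μ.cellsAbove_succ r
    have h2 := ν.cellsAbove_succ r
    rw [h, h r] at h1
    omega
  refine YoungDiagram.ext (Finset.ext fun c => ?_)
  obtain ⟨i, j⟩ := c
  rw [mem_cells, mem_cells, mem_iff_lt_rowLen, mem_iff_lt_rowLen, hrow]

namespace Tableau

theorem eq_of_row_eq_of_col_eq (t : Tableau μ N) {i j : Fin N} (hr : t.tabloid i = t.tabloid j)
    (hc : t.colOf i = t.colOf j) : i = j :=
  t.symm.injective (Subtype.ext (Prod.ext hr hc))

theorem card_tabloid_lt (t : Tableau μ N) (r : ℕ) :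
    (Finset.univ.filter fun i => t.tabloid i < r).card = μ.cellsAbove r := by
  rw [YoungDiagram.cellsAbove]
  refine Finset.card_bij (fun i _ => (t.symm i).1) ?_ ?_ ?_
  · intro i hi
    exact Finset.mem_filter.2 ⟨(t.symm i).2, (Finset.mem_filter.1 hi).2⟩
  · intro i _ j _ h
    exact t.symm.injective (Subtype.ext h)
  · intro c hc
    rw [Finset.mem_filter] at hc
    refine ⟨t ⟨c, hc.1⟩, Finset.mem_filter.2 ⟨Finset.mem_univ _, ?_⟩, ?_⟩
    · simpa [tabloid] using hc.2
    · simp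

/-- Within a column `T` is injective, so at most the minimum of `r` and the column length of its
values are below `r`. The rows of `t` fill a column from the top without gaps and attain this bound.
-/
theorem card_col_lt_le (t : Tableau μ N) {T : Fin N → ℕ}
    (hT : ∀ i j, t.colOf i = t.colOf j → T i = T j → i = j) (c r : ℕ) :
    (Finset.univ.filter fun i => T i < r ∧ t.colOf i = c).card
      ≤ (Finset.univ.filter fun i => t.tabloid i < r ∧ t.colOf i = c).card := by
  by_cases h : ∀ i, t.colOf i = c → t.tabloid i < r
  · refine Finset.card_le_card fun i hi => ?_
    rw [Finset.mem_filter] at hi ⊢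
    exact ⟨hi.1, h i hi.2.2, hi.2.2⟩
  · push Not at h
    obtain ⟨i₀, hc, hr⟩ := h
    have h1 : (Finset.univ.filter fun i => T i < r ∧ t.colOf i = c).card ≤ r := by
      rw [← Finset.card_range r]
      refine Finset.card_le_card_of_injOn T (fun i hi => ?_) fun i hi j hj hij => ?_
      · simpa using (Finset.mem_filter.1 hi).2.1
      · exact hT i j ((Finset.mem_filter.1 hi).2.2.trans (Finset.mem_filter.1 hj).2.2.symm) hij
    have h2 : r ≤ (Finset.univ.filter fun i => t.tabloid i < r ∧ t.colOf i = c).card := by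
      have hmem : ∀ a, a < r → (a, c) ∈ μ.cells := fun a ha =>
        μ.up_left_mem (le_of_lt (lt_of_lt_of_le ha hr)) hc.ge (t.symm i₀).2
      conv_lhs => rw [← Fintype.card_fin r, ← Finset.card_univ]
      refine Finset.card_le_card_of_injOn (fun a : Fin r => t ⟨(a, c), hmem a a.2⟩)
        (fun a _ => ?_) fun a _ b _ hab => ?_
      · rw [Finset.mem_coe, Finset.mem_filter]
        simp [tabloid, colOf]
      · simpa [Fin.ext_iff] using hab
    exact h1.trans h2

theorem card_lt_eq_sum (t : Tableau μ N) (T : Fin N → ℕ) (r : ℕ) :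
    (Finset.univ.filter fun i => T i < r).card
      = ∑ c ∈ Finset.univ.image t.colOf,
        (Finset.univ.filter fun i => T i < r ∧ t.colOf i = c).card := by
  rw [Finset.card_eq_sum_card_fiberwise (f := t.colOf) (t := Finset.univ.image t.colOf)
    fun i _ => by simp]
  simp only [Finset.filter_filter]

theorem card_lt_le_cellsAbove (t : Tableau μ N) {T : Fin N → ℕ}
    (hT : ∀ i j, t.colOf i = t.colOf j → T i = T j → i = j) (r : ℕ) :
    (Finset.univ.filter fun i => T i < r).card ≤ μ.cellsAbove r := by
  rw [← t.card_tabloid_lt, card_lt_eq_sum t T, card_lt_eq_sum t t.tabloid]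
  exact Finset.sum_le_sum fun c _ => t.card_col_lt_le hT c r

/-- Equality in the dominance inequality forces equality in every column, so `T` and the rows of `t`
take the same values on each column. -/
theorem exists_perm_of_injective_on_columns (t : Tableau μ N) {T : Fin N → ℕ}
    (hT : ∀ i j, t.colOf i = t.colOf j → T i = T j → i = j)
    (hcard : ∀ r, (Finset.univ.filter fun i => T i < r).card = μ.cellsAbove r) :
    ∃ q : Equiv.Perm (Fin N), (∀ i, t.colOf (q i) = t.colOf i) ∧ t.tabloid = T ∘ q := by
  have h1 : ∀ r c, (Finset.univ.filter fun i => T i < r ∧ t.colOf i = c).card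
      = (Finset.univ.filter fun i => t.tabloid i < r ∧ t.colOf i = c).card := by
    intro r c
    by_cases hc : c ∈ Finset.univ.image t.colOf
    · have h := hcard r
      rw [← t.card_tabloid_lt, card_lt_eq_sum t T, card_lt_eq_sum t t.tabloid] at h
      exact (Finset.sum_eq_sum_iff_of_le fun c _ => t.card_col_lt_le hT c r).1 h c hc
    · rw [Finset.filter_false_of_mem, Finset.filter_false_of_mem] <;>
      · rintro i - ⟨-, rfl⟩
        exact hc (Finset.mem_image_of_mem _ (Finset.mem_univ i))
  have h2 : ∀ (S : Fin N → ℕ) r c, (Finset.univ.filter fun i => S i < r + 1 ∧ t.colOf i = c).card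
      = (Finset.univ.filter fun i => S i < r ∧ t.colOf i = c).card
        + (Finset.univ.filter fun i => (S i, t.colOf i) = (r, c)).card := by
    intro S r c
    rw [← Finset.card_union_of_disjoint]
    · congr 1
      ext i
      simp only [Finset.mem_filter, Finset.mem_union, Nat.lt_succ_iff_lt_or_eq, Prod.mk.injEq]
      tauto
    · rw [Finset.disjoint_filter]
      rintro i - ⟨h, -⟩ h'
      exact h.ne (Prod.mk.inj h').1
  obtain ⟨q, hq⟩ := exists_perm_comp_eq_of_card_eq (f := fun i => (T i, t.colOf i))
    (g := fun i => (t.tabloid i, t.colOf i)) (by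
      rintro ⟨r, c⟩
      have e1 := h2 T r c
      have e2 := h2 t.tabloid r c
      rw [h1, h1] at e1
      omega)
  exact ⟨q, fun i => (congrArg Prod.snd (congrFun hq i)).symm,
    funext fun i => congrArg Prod.fst (congrFun hq i)⟩

end Tableau

theorem tabloidRep_single (σ : Equiv.Perm (Fin N)) (T : Fin N → ℕ) (c : K) :
    tabloidRep K N σ (Finsupp.single T c) = Finsupp.single (fun i => T (σ⁻¹ i)) c := by
  simp [tabloidRep]

theorem tabloidRep_apply (σ : Equiv.Perm (Fin N)) (v : (Fin N → ℕ) →₀ K) (T : Fin N → ℕ) :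
    tabloidRep K N σ v T = v (T ∘ σ) := by
  have hinj : Function.Injective fun (T : Fin N → ℕ) i => T (σ⁻¹ i) := fun T T' h => by
    funext i
    simpa using congrFun h (σ i)
  have : T = (fun (T : Fin N → ℕ) i => T (σ⁻¹ i)) (T ∘ σ) := by
    funext i
    simp
  conv_lhs => rw [this]
  exact Finsupp.mapDomain_apply hinj _ _

theorem polytabloid_eq_alternator (t : Tableau μ N) : polytabloid K t
    = alternator (tabloidRep K N) t.colOf (Finsupp.single t.tabloid 1) := by
  rw [alternator_apply, polytabloid]

/-- Only the identity preserves both rows and columns, so nothing cancels. -/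
theorem polytabloid_tabloid (t : Tableau μ N) : polytabloid K t t.tabloid = 1 := by
  rw [polytabloid, Finsupp.finsetSum_apply, Finset.sum_eq_single 1]
  · simp
  · intro q hq hq1
    rw [Finsupp.smul_apply, tabloidRep_apply, Finsupp.single_apply, if_neg, smul_zero]
    intro h
    refine hq1 (Equiv.ext fun i => t.eq_of_row_eq_of_col_eq (congrFun h i).symm ?_)
    exact (Finset.mem_filter.1 hq).2 i
  · intro h
    simp at h

/-- The span of the tabloids of shape `ν`. -/
noncomputable def tabloidSpan (K : Type*) [Field K] (N : ℕ) (ν : YoungDiagram) :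
    Submodule K ((Fin N → ℕ) →₀ K) :=
  Submodule.span K {v | ∃ T : Fin N → ℕ,
    (∀ r, (Finset.univ.filter fun i => T i < r).card = ν.cellsAbove r) ∧ v = Finsupp.single T 1}

theorem spechtSub_le_tabloidSpan : (spechtSub K N ν).toSubmodule ≤ tabloidSpan K N ν := by
  refine Submodule.span_le.2 ?_
  rintro _ ⟨s, rfl⟩
  refine Submodule.sum_mem _ fun q _ => Submodule.smul_mem _ _ (Submodule.subset_span ?_)
  refine ⟨_, fun r => ?_, tabloidRep_single q _ _⟩
  rw [← s.card_tabloid_lt r]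
  refine Finset.card_equiv q⁻¹ fun i => ?_
  simp

theorem alternator_single_eq_zero [CharZero K] {f T : Fin N → ℕ} {i j : Fin N} (hij : i ≠ j)
    (hf : f i = f j) (hT : T i = T j) :
    alternator (tabloidRep K N) f (Finsupp.single T 1) = 0 := by
  have h := alternator_rep_apply (ρ := tabloidRep K N) (f := f) (q := Equiv.swap i j)
    (fun a => Equiv.apply_swap_eq_self hf a) (Finsupp.single T 1)
  rw [tabloidRep_single, Equiv.Perm.sign_swap hij] at h
  have hT' : (fun a => T ((Equiv.swap i j)⁻¹ a)) = T := by
    funext a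
    rw [Equiv.swap_inv, Equiv.apply_swap_eq_self hT]
  rw [hT', Units.val_neg, Units.val_one, Int.cast_neg, Int.cast_one, neg_one_smul] at h
  exact self_eq_neg.1 h

/-- The antisymmetrizer kills a tabloid with two entries of a column in one row; a surviving tabloid
is injective on columns, and its shape is dominated by `μ`. -/
theorem cellsAbove_le_of_alternator_ne_zero [CharZero K] (t : Tableau μ N)
    {v : (Fin N → ℕ) →₀ K} (hv : v ∈ tabloidSpan K N ν)
    (h : alternator (tabloidRep K N) t.colOf v ≠ 0) (r : ℕ) : ν.cellsAbove r ≤ μ.cellsAbove r := by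
  by_contra hr
  refine h ((Submodule.span_le.2 ?_ : tabloidSpan K N ν ≤ LinearMap.ker _) hv)
  rintro _ ⟨T, hT, rfl⟩
  rw [SetLike.mem_coe, LinearMap.mem_ker]
  by_contra h0
  refine hr ((hT r).symm.le.trans (t.card_lt_le_cellsAbove (fun i j hc hij => ?_) r))
  by_contra hne
  exact h0 (alternator_single_eq_zero hne hc hij)

theorem alternator_mem_span_polytabloid [CharZero K] (t : Tableau μ N)
    {v : (Fin N → ℕ) →₀ K} (hv : v ∈ tabloidSpan K N μ) :
    ∃ c : K, alternator (tabloidRep K N) t.colOf v = c • polytabloid K t := by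
  have : tabloidSpan K N μ
      ≤ (Submodule.span K {polytabloid K t}).comap (alternator (tabloidRep K N) t.colOf) := by
    refine Submodule.span_le.2 ?_
    rintro _ ⟨T, hT, rfl⟩
    rw [SetLike.mem_coe, Submodule.mem_comap]
    by_cases hinj : ∀ i j, t.colOf i = t.colOf j → T i = T j → i = j
    · obtain ⟨q, hq, hqT⟩ := t.exists_perm_of_injective_on_columns hinj hT
      have : Finsupp.single T (1 : K) = tabloidRep K N q (Finsupp.single t.tabloid 1) := by
        rw [tabloidRep_single, hqT]
        congr 1
        funext i
        simp
      rw [this, alternator_rep_apply hq, ← polytabloid_eq_alternator]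
      exact Submodule.smul_mem _ _ (Submodule.mem_span_singleton_self _)
    · push Not at hinj
      obtain ⟨i, j, hc, hij, hne⟩ := hinj
      rw [alternator_single_eq_zero hne hc hij]
      exact Submodule.zero_mem _
  obtain ⟨c, hc⟩ := Submodule.mem_span_singleton.1 (this hv)
  exact ⟨c, hc.symm⟩

end Tabloids

/-! ### Irreducibility of the Specht modules and their pairwise inequivalence. -/

section SpechtModules

variable {K : Type*} [Field K] {N : ℕ} {μ ν : YoungDiagram}

instance (K : Type*) [Field K] (N : ℕ) (μ : YoungDiagram) :
    FiniteDimensional K (spechtSub K N μ).toSubmodule :=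
  FiniteDimensional.span_of_finite K (Set.finite_range _)

theorem YoungDiagram.nonempty_tableau (h : μ.card = N) : Nonempty (Tableau μ N) :=
  ⟨Fintype.equivFinOfCardEq (by rw [Fintype.card_coe]; exact h)⟩

variable (K) in
/-- The polytabloid as an element of the Specht module. -/
noncomputable def spechtVec (t : Tableau μ N) : (spechtSub K N μ).toSubmodule :=
  ⟨polytabloid K t, Submodule.subset_span ⟨t, rfl⟩⟩

theorem spechtVec_ne_zero (t : Tableau μ N) : spechtVec K t ≠ 0 := by
  intro h
  have := congrArg (fun v : (spechtSub K N μ).toSubmodule => v.1 t.tabloid) h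
  simp [spechtVec, polytabloid_tabloid] at this

theorem alternator_spechtVec (t : Tableau μ N) : ∃ c : ℕ, c ≠ 0 ∧
    alternator (specht K N μ) t.colOf (spechtVec K t) = (c : K) • spechtVec K t := by
  obtain ⟨c, hc, h⟩ := alternator_alternator (ρ := tabloidRep K N) (f := t.colOf)
    (Finsupp.single t.tabloid (1 : K))
  refine ⟨c, hc, Subtype.ext ?_⟩
  rw [← polytabloid_eq_alternator] at h
  exact (coe_alternator (spechtSub K N μ) _).trans h

theorem eq_top_of_spechtVec_mem {t : Tableau μ N} {U : Subrepresentation (specht K N μ)}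
    (h : spechtVec K t ∈ U.toSubmodule) : U = ⊤ := by
  have h1 : ∀ s : Tableau μ N, spechtVec K s ∈ U.toSubmodule := by
    intro s
    have h2 := U.apply_mem_toSubmodule (t.symm.trans s) h
    have h3 : specht K N μ (t.symm.trans s) (spechtVec K t) = spechtVec K s := by
      refine Subtype.ext ((tabloidRep_polytabloid K (t.symm.trans s) t).trans ?_)
      congr 1
      ext c
      simp
    rwa [h3] at h2
  refine Subrepresentation.toSubmodule_injective (eq_top_iff.2 ?_)
  rintro ⟨v, hv⟩ -
  have h2 : (spechtSub K N μ).toSubmodule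
      ≤ U.toSubmodule.map (spechtSub K N μ).toSubmodule.subtype := by
    refine Submodule.span_le.2 ?_
    rintro _ ⟨s, rfl⟩
    exact ⟨_, h1 s, rfl⟩
  obtain ⟨w, hw, hwv⟩ := h2 hv
  rwa [show (⟨v, hv⟩ : (spechtSub K N μ).toSubmodule) = w from Subtype.ext hwv.symm]

theorem isSemisimpleRepresentation_perm [CharZero K] {V : Type*} [AddCommGroup V] [Module K V]
    (ρ : Representation K (Equiv.Perm (Fin N)) V) : ρ.IsSemisimpleRepresentation := by
  have : NeZero (Nat.card (Equiv.Perm (Fin N)) : K) :=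
    ⟨Nat.cast_ne_zero.2 Nat.card_pos.ne'⟩
  infer_instance

/-- The column antisymmetrizer maps the module into the line of one polytabloid and does not kill
that polytabloid. Split the polytabloid along a complement given by Maschke's theorem: one component
survives, so its summand contains the polytabloid, which generates everything. -/
theorem specht_isIrreducible [CharZero K] (hμ : μ.card = N) :
    Representation.IsIrreducible (V := (spechtSub K N μ).toSubmodule) (specht K N μ) := by
  obtain ⟨t⟩ := YoungDiagram.nonempty_tableau hμ
  have halt : ∀ v, ∃ c : K, alternator (specht K N μ) t.colOf v = c • spechtVec K t := by
    intro v
    obtain ⟨c, hc⟩ := alternator_mem_span_polytabloid t (spechtSub_le_tabloidSpan v.2)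
    exact ⟨c, Subtype.ext ((coe_alternator (spechtSub K N μ) v).trans hc)⟩
  have hmem : ∀ (U : Subrepresentation (specht K N μ)) (v), v ∈ U.toSubmodule →
      alternator (specht K N μ) t.colOf v ≠ 0 → U = ⊤ := by
    intro U v hv hne
    obtain ⟨c, hc⟩ := halt v
    have hc0 : c ≠ 0 := by
      rintro rfl
      exact hne (by rw [hc, zero_smul])
    have h1 : alternator (specht K N μ) t.colOf v ∈ U.toSubmodule := by
      rw [alternator_apply]
      exact Submodule.sum_mem _ fun q _ =>
        Submodule.smul_mem _ _ (U.apply_mem_toSubmodule q hv)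
    rw [hc] at h1
    exact eq_top_of_spechtVec_mem ((Submodule.smul_mem_iff _ hc0).1 h1)
  obtain ⟨c, hc, hct⟩ := alternator_spechtVec (K := K) t
  have hne : alternator (specht K N μ) t.colOf (spechtVec K t) ≠ 0 := by
    rw [hct]
    exact smul_ne_zero (Nat.cast_ne_zero.2 hc) (spechtVec_ne_zero t)
  refine { exists_pair_ne := ⟨⊥, ⊤, fun h => ?_⟩, eq_bot_or_eq_top := fun U => ?_ }
  · have : spechtVec K t ∈ (⊥ : Subrepresentation (specht K N μ)).toSubmodule := by
      rw [h]
      exact Submodule.mem_top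
    exact spechtVec_ne_zero t ((Submodule.mem_bot K).1 this)
  · have hss : Representation.IsSemisimpleRepresentation (V := (spechtSub K N μ).toSubmodule)
        (specht K N μ) := isSemisimpleRepresentation_perm _
    obtain ⟨U', hU⟩ := hss.exists_isCompl U
    have hsup : spechtVec K t ∈ (U ⊔ U').toSubmodule := by
      rw [hU.sup_eq_top]
      exact Submodule.mem_top
    rw [Subrepresentation.toSubmodule_sup] at hsup
    obtain ⟨u, hu, u', hu', huu⟩ := Submodule.mem_sup.1 hsup
    by_cases h : alternator (specht K N μ) t.colOf u = 0
    · left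
      have hU' : U' = ⊤ := hmem U' u' hu' fun h' => hne (by rw [← huu, map_add, h, h', add_zero])
      have := hU.inf_eq_bot
      rwa [hU', inf_top_eq] at this
    · exact Or.inr (hmem U u hu h)

theorem cellsAbove_le_of_intertwiningMap [CharZero K] (hμ : μ.card = N)
    (φ : (specht K N μ).IntertwiningMap (specht K N ν)) (hφ : φ ≠ 0) (r : ℕ) :
    ν.cellsAbove r ≤ μ.cellsAbove r := by
  obtain ⟨t⟩ := YoungDiagram.nonempty_tableau hμ
  have h1 : φ (spechtVec K t) ≠ 0 := by
    intro h0
    have hker : φ.ker = ⊤ := eq_top_of_spechtVec_mem (t := t) h0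
    refine hφ (DFunLike.ext _ _ fun v => ?_)
    have : v ∈ φ.ker.toSubmodule := by
      rw [hker]
      exact Submodule.mem_top
    exact this
  obtain ⟨c, hc, hct⟩ := alternator_spechtVec (K := K) t
  refine cellsAbove_le_of_alternator_ne_zero t
    (spechtSub_le_tabloidSpan (φ (spechtVec K t)).2) ?_ r
  rw [← coe_alternator (spechtSub K N ν)]
  have h2 : φ (alternator (specht K N μ) t.colOf (spechtVec K t))
      = alternator (specht K N ν) t.colOf (φ (spechtVec K t)) :=
    map_alternator (V := (spechtSub K N μ).toSubmodule) (V' := (spechtSub K N ν).toSubmodule) φ _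
  rw [hct, map_smul] at h2
  intro h
  refine smul_ne_zero (Nat.cast_ne_zero.2 hc) h1 (h2.trans ?_)
  exact Subtype.ext h

/-- By Schur's lemma the map is invertible; the map and its inverse give dominance in both
directions. -/
theorem eq_of_specht_intertwiningMap [CharZero K] (hμ : μ.card = N) (hν : ν.card = N)
    (φ : (specht K N μ).IntertwiningMap (specht K N ν)) (hφ : φ ≠ 0) : μ = ν := by
  have := specht_isIrreducible (K := K) hμ
  have := specht_isIrreducible (K := K) hν
  have hb := (Representation.IsIrreducible.bijective_or_eq_zero
    (V := (spechtSub K N μ).toSubmodule) (W := (spechtSub K N ν).toSubmodule) φ).resolve_right hφ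
  let e := φ.ofBijective hb
  refine YoungDiagram.eq_of_cellsAbove_eq fun r => le_antisymm
    (cellsAbove_le_of_intertwiningMap hν e.symm.toIntertwiningMap (fun h => ?_) r)
    (cellsAbove_le_of_intertwiningMap hμ φ hφ r)
  refine hφ (DFunLike.ext _ _ fun v => ?_)
  have h1 : e.symm (e v) = 0 := DFunLike.congr_fun h (e v)
  rw [e.symm_apply_apply] at h1
  rw [h1, map_zero]
  rfl

end SpechtModules

/-! ### Completeness of the Specht modules by counting characters. -/

section Completeness

variable {K : Type*} [Field K] {N : ℕ}

theorem card_le_card_of_orthogonal {ι P G : Type*} [Fintype ι] [Fintype P] [Fintype G]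
    (τ : G → P) (w : ι → P → K) (horth : ∀ i j, i ≠ j → ∑ g, w i (τ g) * w j (τ g) = 0)
    (hself : ∀ i, ∑ g, w i (τ g) * w i (τ g) ≠ 0) : Fintype.card ι ≤ Fintype.card P := by
  classical
  have hli : LinearIndependent K w := by
    refine Fintype.linearIndependent_iff.2 fun c hc j => ?_
    have h1 : ∑ g, (∑ i, c i • w i) (τ g) * w j (τ g) = c j * ∑ g, w j (τ g) * w j (τ g) := by
      simp only [Finset.sum_apply, Pi.smul_apply, smul_eq_mul, Finset.sum_mul]
      rw [Finset.sum_comm, Finset.sum_eq_single j]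
      · rw [Finset.mul_sum]
        exact Finset.sum_congr rfl fun g _ => mul_assoc _ _ _
      · intro i _ hij
        simp only [mul_assoc]
        rw [← Finset.mul_sum, horth i j hij, mul_zero]
      · exact fun h => absurd (Finset.mem_univ j) h
    rw [hc] at h1
    simp only [Pi.zero_apply, zero_mul, Finset.sum_const_zero] at h1
    exact (mul_eq_zero.1 h1.symm).resolve_right (hself j)
  have := hli.fintype_card_le_finrank
  rwa [Module.finrank_fintype_fun_eq_card] at this

theorem YoungDiagram.card_ofRowLens (w : List ℕ) (hw : w.SortedGE) :
    (YoungDiagram.ofRowLens w hw).card = w.sum := by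
  change (YoungDiagram.cellsOfRowLens w).card = w.sum
  clear hw
  induction w with
  | nil => rfl
  | cons a w ih =>
    rw [YoungDiagram.cellsOfRowLens, Finset.card_union_of_disjoint, Finset.card_map, ih,
      Finset.card_product, Finset.card_singleton, Finset.card_range, one_mul, List.sum_cons]
    rw [Finset.disjoint_left]
    rintro ⟨i, j⟩ hc hc'
    simp only [Finset.mem_product, Finset.mem_singleton] at hc
    simp only [Finset.mem_map, Function.Embedding.coe_prodMap] at hc'
    obtain ⟨⟨i', j'⟩, -, h⟩ := hc'
    have := congrArg Prod.fst h
    simp only [Prod.map_fst, Function.Embedding.coeFn_mk] at this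
    omega

/-- The Young diagram of a partition. -/
noncomputable def Nat.Partition.youngDiagram {M : ℕ} (π : M.Partition) : YoungDiagram :=
  YoungDiagram.ofRowLens (π.parts.sort (· ≥ ·)) (Multiset.pairwise_sort _ _).sortedGE

theorem Nat.Partition.card_youngDiagram {M : ℕ} (π : M.Partition) : π.youngDiagram.card = M := by
  rw [youngDiagram, YoungDiagram.card_ofRowLens, ← Multiset.sum_coe, Multiset.sort_eq,
    π.parts_sum]

theorem Nat.Partition.youngDiagram_injective {M : ℕ} :
    Function.Injective (Nat.Partition.youngDiagram (M := M)) := by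
  intro π π' h
  have hrow : ∀ π : M.Partition, π.youngDiagram.rowLens = π.parts.sort (· ≥ ·) := fun π =>
    YoungDiagram.rowLens_ofRowLens_eq_self fun x hx =>
      π.parts_pos ((Multiset.mem_sort (· ≥ ·)).1 hx)
  have h2 := congrArg YoungDiagram.rowLens h
  rw [hrow, hrow] at h2
  refine Nat.Partition.ext ?_
  rw [← Multiset.sort_eq π.parts (· ≥ ·), h2, Multiset.sort_eq]

section character

variable {V W : Type*} [AddCommGroup V] [Module K V] [AddCommGroup W] [Module K W]

theorem character_eq_of_partition_eq (ρ : Representation K (Equiv.Perm (Fin N)) V)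
    {σ τ : Equiv.Perm (Fin N)} (h : σ.partition = τ.partition) :
    ρ.character σ = ρ.character τ := by
  obtain ⟨g, rfl⟩ := isConj_iff.1 (Equiv.Perm.partition_eq_of_isConj.2 h)
  rw [Representation.char_conj]

/-- A permutation is conjugate to its inverse, so no inverse is needed in the character pairing.
Only whether the dimension vanishes matters later, so `K` need not be algebraically closed. -/
theorem sum_character_mul_character [CharZero K] [FiniteDimensional K V]
    [FiniteDimensional K W] (ρ : Representation K (Equiv.Perm (Fin N)) V)
    (σ : Representation K (Equiv.Perm (Fin N)) W) :
    ∑ g, ρ.character g * σ.character g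
      = (Nat.card (Equiv.Perm (Fin N)) : K) * Module.finrank K (ρ.IntertwiningMap σ) := by
  have hc : (Nat.card (Equiv.Perm (Fin N)) : K) ≠ 0 := Nat.cast_ne_zero.2 Nat.card_pos.ne'
  let _ : Invertible (Nat.card (Equiv.Perm (Fin N)) : K) := invertibleOfNonzero hc
  rw [← Representation.card_inv_mul_sum_char_mul_char_eq_finrank, ← mul_assoc,
    mul_inv_cancel₀ hc, one_mul]
  refine Finset.sum_congr rfl fun g _ => ?_
  rw [mul_comm, character_eq_of_partition_eq ρ (σ := g) (τ := g⁻¹)]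
  rw [← Equiv.Perm.partition_eq_of_isConj, Equiv.Perm.isConj_iff_cycleType_eq,
    Equiv.Perm.cycleType_inv]

/-- The character as a function of the cycle type. -/
noncomputable def cycleTypeCharacter (ρ : Representation K (Equiv.Perm (Fin N)) V) :
    (Fintype.card (Fin N)).Partition → K :=
  Function.extend Equiv.Perm.partition ρ.character 0

theorem cycleTypeCharacter_partition (ρ : Representation K (Equiv.Perm (Fin N)) V)
    (g : Equiv.Perm (Fin N)) : cycleTypeCharacter ρ g.partition = ρ.character g :=
  Function.FactorsThrough.extend_apply (fun _ _ h => character_eq_of_partition_eq ρ h) _ _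

theorem sum_cycleTypeCharacter_eq_zero [CharZero K] [FiniteDimensional K V]
    [FiniteDimensional K W]
    (ρ : Representation K (Equiv.Perm (Fin N)) V) (σ : Representation K (Equiv.Perm (Fin N)) W)
    (h : ∀ φ : ρ.IntertwiningMap σ, φ = 0) : ∑ g : Equiv.Perm (Fin N),
      cycleTypeCharacter ρ g.partition * cycleTypeCharacter σ g.partition = 0 := by
  simp only [cycleTypeCharacter_partition]
  have : Subsingleton (ρ.IntertwiningMap σ) := ⟨fun φ ψ => (h φ).trans (h ψ).symm⟩
  rw [sum_character_mul_character, Module.finrank_zero_of_subsingleton, Nat.cast_zero, mul_zero]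

theorem sum_cycleTypeCharacter_ne_zero [CharZero K] [FiniteDimensional K V]
    (ρ : Representation K (Equiv.Perm (Fin N)) V) {v : V} (hv : v ≠ 0) : ∑ g : Equiv.Perm (Fin N),
      cycleTypeCharacter ρ g.partition * cycleTypeCharacter ρ g.partition ≠ 0 := by
  simp only [cycleTypeCharacter_partition]
  have : Nontrivial (ρ.IntertwiningMap ρ) := ⟨⟨1, 0, fun h => hv (DFunLike.congr_fun h v)⟩⟩
  rw [sum_character_mul_character]
  exact mul_ne_zero (Nat.cast_ne_zero.2 Nat.card_pos.ne')
    (Nat.cast_ne_zero.2 Module.finrank_pos.ne')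

end character

theorem finiteDimensional_of_isIrreducible {G V : Type*} [Group G] [Finite G] [AddCommGroup V]
    [Module K V] (ρ : Representation K G V) (hρ : ρ.IsIrreducible) : FiniteDimensional K V := by
  by_cases h : ∃ v : V, v ≠ 0
  · obtain ⟨v, hv⟩ := h
    let U : Subrepresentation ρ :=
      { toSubmodule := Submodule.span K (Set.range fun g => ρ g v)
        apply_mem_toSubmodule := fun g w hw => by
          have : Submodule.span K (Set.range fun g => ρ g v)
              ≤ (Submodule.span K (Set.range fun g => ρ g v)).comap (ρ g) := by
            refine Submodule.span_le.2 ?_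
            rintro _ ⟨h, rfl⟩
            refine Submodule.subset_span ⟨g * h, ?_⟩
            change ρ (g * h) v = ρ g (ρ h v)
            rw [map_mul]
            rfl
          exact this hw }
    have hvU : v ∈ U.toSubmodule := Submodule.subset_span ⟨1, by simp⟩
    have hU : U = ⊤ := by
      refine (hρ.eq_bot_or_eq_top U).resolve_left fun h => hv ?_
      rw [h] at hvU
      exact (Submodule.mem_bot K).1 hvU
    have htop : Submodule.span K (Set.range fun g => ρ g v) = ⊤ :=
      congrArg Subrepresentation.toSubmodule hU
    exact Module.finite_def.2 (htop ▸ Submodule.fg_span (Set.finite_range _))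
  · push Not at h
    have : Subsingleton V := ⟨fun a b => (h a).trans (h b).symm⟩
    infer_instance

theorem sum_cycleTypeCharacter_specht_ne_zero [CharZero K] {μ : YoungDiagram} (t : Tableau μ N) :
    ∑ g : Equiv.Perm (Fin N),
      cycleTypeCharacter (V := (spechtSub K N μ).toSubmodule) (specht K N μ) g.partition *
      cycleTypeCharacter (V := (spechtSub K N μ).toSubmodule) (specht K N μ) g.partition ≠ 0 := by
  have := fun v hv => sum_cycleTypeCharacter_ne_zero (V := (spechtSub K N μ).toSubmodule)
    (specht K N μ) (v := v) hv
  exact this (spechtVec K t) (spechtVec_ne_zero t)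

/-- Every irreducible representation of a symmetric group in characteristic zero is a Specht
module. -/
theorem exists_equiv_specht [CharZero K] {V : Type*} [AddCommGroup V] [Module K V]
    (ρ : Representation K (Equiv.Perm (Fin N)) V) (hρ : ρ.IsIrreducible) :
    ∃ μ : YoungDiagram, μ.card = N ∧ Nonempty (ρ.Equiv (specht K N μ)) := by
  by_contra! hne
  have hfd := finiteDimensional_of_isIrreducible ρ hρ
  have hcard : ∀ π : (Fintype.card (Fin N)).Partition, π.youngDiagram.card = N := fun π => by
    rw [π.card_youngDiagram, Fintype.card_fin]
  obtain ⟨v, hv⟩ : ∃ v : V, v ≠ 0 := by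
    by_contra! h
    have : Subsingleton V := ⟨fun a b => (h a).trans (h b).symm⟩
    refine bot_ne_top (α := Subrepresentation ρ) (Subrepresentation.toSubmodule_injective ?_)
    exact Subsingleton.elim _ _
  have hzero : ∀ (π : (Fintype.card (Fin N)).Partition)
      (φ : ρ.IntertwiningMap (specht K N π.youngDiagram)), φ = 0 := by
    intro π φ
    have := specht_isIrreducible (K := K) (hcard π)
    refine (Representation.IsIrreducible.bijective_or_eq_zero
      (W := (spechtSub K N π.youngDiagram).toSubmodule) φ).resolve_left fun h => ?_
    exact (hne _ (hcard π)).false (φ.ofBijective h)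
  have hzero' : ∀ (π : (Fintype.card (Fin N)).Partition)
      (φ : (specht K N π.youngDiagram).IntertwiningMap ρ), φ = 0 := by
    intro π φ
    have := specht_isIrreducible (K := K) (hcard π)
    refine (Representation.IsIrreducible.bijective_or_eq_zero
      (V := (spechtSub K N π.youngDiagram).toSubmodule) φ).resolve_left fun h => ?_
    exact (hne _ (hcard π)).false (φ.ofBijective h).symm
  -- There is one Specht module per cycle type; a further irreducible would give one orthogonal
  -- function too many on the cycle types.
  have := card_le_card_of_orthogonal (K := K) (ι := Option (Fintype.card (Fin N)).Partition)
    (fun g : Equiv.Perm (Fin N) => g.partition)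
    (fun o => o.elim (cycleTypeCharacter ρ) fun π =>
      cycleTypeCharacter (V := (spechtSub K N π.youngDiagram).toSubmodule)
        (specht K N π.youngDiagram)) ?_ ?_
  · rw [Fintype.card_option] at this
    omega
  · rintro (_ | π) (_ | π') h
    · exact absurd rfl h
    · exact sum_cycleTypeCharacter_eq_zero
        (W := (spechtSub K N π'.youngDiagram).toSubmodule) _ _ (hzero π')
    · exact sum_cycleTypeCharacter_eq_zero
        (V := (spechtSub K N π.youngDiagram).toSubmodule) _ _ (hzero' π)
    · refine sum_cycleTypeCharacter_eq_zero (V := (spechtSub K N π.youngDiagram).toSubmodule)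
        (W := (spechtSub K N π'.youngDiagram).toSubmodule) _ _ fun φ => ?_
      by_contra hφ
      have := eq_of_specht_intertwiningMap (hcard π) (hcard π') φ hφ
      exact h (by rw [Nat.Partition.youngDiagram_injective this])
  · rintro (_ | π)
    · exact sum_cycleTypeCharacter_ne_zero ρ hv
    · obtain ⟨t⟩ := YoungDiagram.nonempty_tableau (hcard π)
      exact sum_cycleTypeCharacter_specht_ne_zero t

end Completeness

/-! ### The number of columns of a constituent. -/

section Columns

variable {K : Type*} [Field K] {N : ℕ} {μ : YoungDiagram}

/-- The row symmetrization of a polytabloid does not vanish. -/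
theorem exists_row_symmetric_specht [CharZero K] (t : Tableau μ N) :
    ∃ v : (spechtSub K N μ).toSubmodule, v ≠ 0 ∧ ∀ q : Equiv.Perm (Fin N),
      (∀ i, t.tabloid (q i) = t.tabloid i) → specht K N μ q v = v := by
  classical
  let R := Finset.univ.filter fun q : Equiv.Perm (Fin N) => ∀ i, t.tabloid (q i) = t.tabloid i
  refine ⟨∑ r ∈ R, specht K N μ r (spechtVec K t), fun h => ?_, fun q hq => ?_⟩
  -- The tabloid of `t` is fixed by the row group, so each summand has coefficient `1` there, and
  -- the total is the order of that group.
  · have h1 := congrArg (fun v : (spechtSub K N μ).toSubmodule => v.1 t.tabloid) h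
    simp only [AddSubmonoidClass.coe_finsetSum, Finsupp.finsetSum_apply] at h1
    rw [Finset.sum_congr rfl (g := fun _ => (1 : K))] at h1
    · rw [Finset.sum_const, nsmul_one] at h1
      refine Nat.cast_ne_zero.2 (Finset.card_ne_zero_of_mem (a := 1) ?_) h1
      simp [R]
    · intro r hr
      have h2 : t.tabloid ∘ r = t.tabloid := funext (Finset.mem_filter.1 hr).2
      change tabloidRep K N r (polytabloid K t) t.tabloid = 1
      rw [tabloidRep_apply, h2, polytabloid_tabloid]
  · rw [map_sum]
    refine Finset.sum_bij (fun r _ => q * r) ?_ (fun _ _ _ _ h => mul_left_cancel h) ?_ ?_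
    · intro r hr
      simp only [R, Finset.mem_filter, Finset.mem_univ, true_and] at hr ⊢
      intro a
      rw [Equiv.Perm.mul_apply, hq, hr]
    · intro r hr
      refine ⟨q⁻¹ * r, ?_, mul_inv_cancel_left q r⟩
      simp only [R, Finset.mem_filter, Finset.mem_univ, true_and] at hr ⊢
      intro a
      rw [Equiv.Perm.mul_apply, preserves_inv hq, hr]
    · intro r _
      rw [map_mul]
      rfl

theorem specht_apply_spechtVec (t : Tableau μ N) {q : Equiv.Perm (Fin N)}
    (hq : ∀ i, t.colOf (q i) = t.colOf i) :
    specht K N μ q (spechtVec K t) = ((Equiv.Perm.sign q : ℤ) : K) • spechtVec K t := by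
  refine Subtype.ext ?_
  change tabloidRep K N q (polytabloid K t) = ((Equiv.Perm.sign q : ℤ) : K) • polytabloid K t
  rw [polytabloid_eq_alternator, rep_alternator_apply hq]

theorem Tableau.colOf_lt_numCols (t : Tableau μ N) (i : Fin N) : t.colOf i < μ.numCols := by
  rw [YoungDiagram.numCols, ← YoungDiagram.mem_iff_lt_rowLen]
  exact μ.up_left_mem (Nat.zero_le _) le_rfl (t.symm i).2

theorem Tableau.card_first_row (t : Tableau μ N) :
    (Finset.univ.filter fun i => t.tabloid i = 0).card = μ.numCols := by
  have h := t.card_tabloid_lt 1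
  have h0 : μ.cellsAbove 0 = 0 := by
    rw [YoungDiagram.cellsAbove, Finset.card_eq_zero, Finset.filter_eq_empty_iff]
    intro c _
    exact Nat.not_lt_zero _
  rw [μ.cellsAbove_succ, h0, zero_add] at h
  rw [YoungDiagram.numCols, ← h]
  simp only [Nat.lt_one_iff]

/-- The image of a row-symmetric vector excludes more than `k` columns, since the first row has as
many entries as there are columns; the image of a polytabloid excludes fewer than `k`, the columns
serving as the alternating classes. -/
theorem numCols_eq_of_injective_intertwiningMap [CharZero K] {n k : ℕ} (hk : 1 ≤ k) (hkn : k ≤ n)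
    {μ : YoungDiagram} (hμ : μ.card = k * (n - 1) + 1)
    (f : (specht K (k * (n - 1) + 1) μ).IntertwiningMap (rho K n k))
    (hf : Function.Injective f) : μ.numCols = k := by
  obtain ⟨p, rfl⟩ := Nat.exists_eq_add_of_le' (hk.trans hkn)
  obtain ⟨m, rfl⟩ := Nat.exists_eq_add_of_le' hk
  obtain ⟨t⟩ := YoungDiagram.nonempty_tableau hμ
  have hX : Fintype.card (Fin ((m + 1) * (p + 1 - 1) + 1)) = (m + 1) * p + 1 := by
    rw [Fintype.card_fin, Nat.add_sub_cancel]
  have hrep : ∀ q v, freeFilippovRep K (p + 1) _ q (f v).1 = (f (specht K _ μ q v)).1 :=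
    fun q v => by
      have h := Representation.IntertwiningMap.isIntertwining _ _ f q v
      exact congrArg Subtype.val h.symm
  have hne : ∀ v, v ≠ 0 → (f v).1 ≠ 0 := fun v hv h => hv (hf (by
    rw [map_zero]
    exact Subtype.ext h))
  refine le_antisymm ?_ ?_
  · by_contra! hlt
    obtain ⟨v, hv, hvr⟩ := exists_row_symmetric_specht (K := K) t
    refine hne v hv (eq_zero_of_symmetric hX hk t.tabloid
      (R := Finset.univ.filter fun i => t.tabloid i = 0) (by rwa [t.card_first_row]) ?_ (f v).2 ?_)
    · intro a ha b hb
      rw [(Finset.mem_filter.1 ha).2, (Finset.mem_filter.1 hb).2]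
    · intro q hq
      rw [hrep, hvr q hq]
  · by_contra! hlt
    have hcol : ∀ i, t.colOf i < m := fun i => by
      have := t.colOf_lt_numCols i
      omega
    refine hne _ (spechtVec_ne_zero (K := K) t) (eq_zero_of_alternating hX (by omega)
      (fun i => (⟨t.colOf i, hcol i⟩ : Fin m)) (f (spechtVec K t)).2 ?_)
    intro q hq
    rw [hrep, specht_apply_spechtVec t fun i => by simpa using hq i, map_smul]
    rfl

end Columns

theorem mainTheorem2 (K : Type*) [Field K] [CharZero K] (n k : ℕ) (hk : 1 ≤ k) (hkn : k ≤ n) :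
    (∀ W : Subrepresentation (rho K n k), Representation.IsIrreducible (V := W.toSubmodule) W.toRepresentation →
      ∃ μ : YoungDiagram, μ.card = k * (n - 1) + 1 ∧ μ.numCols = k ∧
        Nonempty (W.toRepresentation.Equiv (specht K (k * (n - 1) + 1) μ))) ∧
    (∀ μ : YoungDiagram, μ.card = k * (n - 1) + 1 →
      (∃ f : (specht K (k * (n - 1) + 1) μ).IntertwiningMap (rho K n k), Function.Injective f) →
        μ.numCols = k) := by
  have hsecond : ∀ μ : YoungDiagram, μ.card = k * (n - 1) + 1 →
      (∃ f : (specht K (k * (n - 1) + 1) μ).IntertwiningMap (rho K n k), Function.Injective f) →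
        μ.numCols = k := fun μ hμ ⟨f, hf⟩ =>
    numCols_eq_of_injective_intertwiningMap hk hkn hμ f hf
  refine ⟨fun W hW => ?_, hsecond⟩
  obtain ⟨μ, hμ, ⟨e⟩⟩ := exists_equiv_specht (V := W.toSubmodule) W.toRepresentation hW
  refine ⟨μ, hμ, hsecond μ hμ ⟨⟨W.toSubmodule.subtype ∘ₗ e.symm.toIntertwiningMap.toLinearMap,
    fun g => ?_⟩, ?_⟩, ⟨e⟩⟩
  · ext v
    have h := congrArg (fun φ : (spechtSub K _ μ).toSubmodule →ₗ[K] W.toSubmodule => φ v)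
      (e.symm.toIntertwiningMap.isIntertwining' g)
    exact congrArg (fun w : W.toSubmodule => w.1.1) h
  · exact Subtype.val_injective.comp (EquivLike.injective e.symm)
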